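/- Let $N\ge 1$ be an integer, let $|\cdot|$ be a norm on $\mathbb{R}^N$, let $R>0$ and $1\le p<\infty$. For $a<b$ let $W^{1,p}([a,b],\mathbb{R}^N)$ be the space of absolutely continuous functions $x\colon[a,b]\to\mathbb{R}^N$ whose almost everywhere derivative $x'$ belongs to $L^p([a,b],\mathbb{R}^N)$, with the norm $\|x\|=\bigl(|x(a)|^p+\int_a^b|x'(t)|^p\,dt\bigr)^{1/p}$. Let $f\colon\mathbb{R}^N\times\mathbb{R}^N\to\mathbb{R}^N$ be of class $C^1$. For $\varphi\in W^{1,p}([-R,0],\mathbb{R}^N)$ and $r\in[0,R]$ consider the initial value problem $$\dot x(t)=f\bigl(x(t),x(t-r)\bigr)\quad(t\ge 0),\qquad x(t)=\varphi(t)\quad(t\in[-R,0]),$$ where $\dot x(0)$ is the right-hand derivative, and let $x(\cdot;\varphi,r)\colon[-R,T_{\varphi,r})\to\mathbb{R}^N$, $0<T_{\varphi,r}\le\infty$, be its unique maximal solution. Let $B\subset W^{1,p}([-R,0],\mathbb{R}^N)$ be an open set that is bounded with respect to the supremum norm. Then there exists $T>0$ such that: 1. (well-definedness) for every $(\varphi,r)\in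 B\times[0,R]$ the unique maximal solution exists, $T<T_{\varphi,r}$, and $x(\cdot;\varphi,r)|_{[-R,T]}\in W^{1,p}([-R,T],\mathbb{R}^N)$; 2. the map $$B\times[0,R]\ni(\varphi,r)\mapsto x(\cdot;\varphi,r)|_{[-R,T]}\in W^{1,p}([-R,T],\mathbb{R}^N)$$ is continuously Fréchet differentiable (the delay $r=0$ is included). Here a map $g\colon U\to Y$ on a (not necessarily open) subset $U$ of a normed space $X$, with values in a normed space $Y$, is called continuously Fréchet differentiable if every point of $U$ is a limit point of $U$, for every $u_0\in U$ there is a unique bounded linear operator $Dg(u_0)\colon X\to Y$ with $\|g(u)-g(u_0)-Dg(u_0)(u-u_0)\|=o(\|u-u_0\|)$ as $u\to u_0$ in $U$, and $Dg\colon U\to\mathcal{L}(X,Y)$ is continuous in the operator norm. In (2), $X=W^{1,p}([-R,0],\mathbb{R}^N)\times\mathbb{R}$ and $U=B\times[0,R]$. -/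

import Mathlib

open Set MeasureTheory Filter Topology
open scoped ENNReal

noncomputable section

namespace DelayEq

variable {E : Type*} [NormedAddCommGroup E] [NormedSpace ℝ E]

/-! ### Absolutely continuous functions: facts needed for the norm -/

section Facts

variable [FiniteDimensional ℝ E] {x y : ℝ → E} {a b : ℝ}

theorem ac_ae_differentiableAt (hx : AbsolutelyContinuousOnInterval x a b) :
    ∀ᵐ t ∂(volume.restrict (Icc a b)), DifferentiableAt ℝ x t := by
  rw [ae_restrict_iff' measurableSet_Icc]
  filter_upwards [hx.boundedVariationOn.ae_differentiableAt_of_mem_uIcc] with t ht hmem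
  exact ht (Icc_subset_uIcc hmem)

theorem ac_deriv_add (hx : AbsolutelyContinuousOnInterval x a b)
    (hy : AbsolutelyContinuousOnInterval y a b) :
    deriv (x + y) =ᵐ[volume.restrict (Icc a b)] deriv x + deriv y := by
  filter_upwards [ac_ae_differentiableAt hx, ac_ae_differentiableAt hy] with t h1 h2
  simpa using deriv_add h1 h2

theorem ac_deriv_smul (c : ℝ) (hx : AbsolutelyContinuousOnInterval x a b) :
    deriv (c • x) =ᵐ[volume.restrict (Icc a b)] c • deriv x := by
  filter_upwards [ac_ae_differentiableAt hx] with t h1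
  simpa using deriv_const_smul c h1

theorem ac_eq_of_deriv_eq_zero (hx : AbsolutelyContinuousOnInterval x a b)
    (h0 : deriv x =ᵐ[volume.restrict (Icc a b)] 0) (t : ℝ) (ht : t ∈ Icc a b) : x t = x a := by
  have hab : a ≤ b := ht.1.trans ht.2
  obtain ⟨C, hC⟩ := hx.const_of_ae_hasDerivAt_zero (by
    rw [uIcc_of_le hab, ← ae_restrict_iff' measurableSet_Icc]
    filter_upwards [ac_ae_differentiableAt hx, h0] with s h1 h2
    simpa [h2] using h1.hasDerivAt)
  rw [hC t (Icc_subset_uIcc ht), hC a left_mem_uIcc]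

end Facts

/-! ### The space `W^{1,p}([a, b], E)` -/

variable (E) in
/-- The functions `x : [a, b] → E` that are absolutely continuous and whose almost everywhere
derivative lies in `L^p([a, b], E)`. A function on `[a, b]` is represented by its extension by `0`
to the real line; absolute continuity on `[a, b]` and the derivative at the points of `(a, b)` see
only the values on `[a, b]`. -/
def sobolevSubmodule [FiniteDimensional ℝ E] (p : ℝ≥0∞) (a b : ℝ) : Submodule ℝ (ℝ → E) where
  carrier := {x | (∀ t, t ∉ Icc a b → x t = 0) ∧ AbsolutelyContinuousOnInterval x a b ∧
    MemLp (deriv x) p (volume.restrict (Icc a b))}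
  zero_mem' := by
    refine ⟨fun _ _ => rfl, ?_, ?_⟩
    · exact (LipschitzWith.const (0 : E)).lipschitzOnWith.absolutelyContinuousOnInterval
    · have h : deriv (0 : ℝ → E) = 0 := by
        funext t
        exact deriv_const t (0 : E)
      rw [h]
      exact MemLp.zero
  add_mem' := by
    rintro x y ⟨hx0, hx1, hx2⟩ ⟨hy0, hy1, hy2⟩
    refine ⟨fun t ht => by simp [hx0 t ht, hy0 t ht], hx1.add hy1, ?_⟩
    exact (memLp_congr_ae (ac_deriv_add hx1 hy1)).2 (hx2.add hy2)
  smul_mem' := by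
    rintro c x ⟨hx0, hx1, hx2⟩
    refine ⟨fun t ht => by simp [hx0 t ht], hx1.const_smul c, ?_⟩
    exact (memLp_congr_ae (ac_deriv_smul c hx1)).2 (hx2.const_smul c)

variable (E) in
/-- The linear space `W^{1,p}([a, b], E)`; its norm is defined below. -/
def Sobolev [FiniteDimensional ℝ E] (p : ℝ≥0∞) (a b : ℝ) : Type _ :=
  ↥(sobolevSubmodule E p a b)

namespace Sobolev

variable [FiniteDimensional ℝ E] {p : ℝ≥0∞} {a b : ℝ}

instance : AddCommGroup (Sobolev E p a b) :=
  inferInstanceAs (AddCommGroup ↥(sobolevSubmodule E p a b))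

instance : Module ℝ (Sobolev E p a b) :=
  inferInstanceAs (Module ℝ ↥(sobolevSubmodule E p a b))

/-- The values of an element of `W^{1,p}([a, b], E)`. -/
instance : CoeFun (Sobolev E p a b) (fun _ => ℝ → E) := ⟨fun x => x.1⟩

/-- The linear map `x ↦ (x a, x')` into `E × L^p([a, b], E)`, the latter with the norm
`(‖u‖ ^ p + ‖v‖ ^ p) ^ (1 / p)`. -/
def toProd : Sobolev E p a b →ₗ[ℝ] WithLp p (E × Lp E p (volume.restrict (Icc a b))) where
  toFun x := WithLp.toLp p (x a, x.2.2.2.toLp (deriv x))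
  map_add' x y := by
    rw [← WithLp.toLp_add, Prod.mk_add_mk, ← MemLp.toLp_add]
    congr 2
    exact MemLp.toLp_congr _ _ (ac_deriv_add x.2.2.1 y.2.2.1)
  map_smul' c x := by
    rw [RingHom.id_apply, ← WithLp.toLp_smul, Prod.smul_mk, ← MemLp.toLp_const_smul]
    congr 2
    exact MemLp.toLp_congr _ _ (ac_deriv_smul c x.2.2.1)

theorem toProd_injective : Function.Injective (toProd : Sobolev E p a b →ₗ[ℝ] _) := by
  rw [injective_iff_map_eq_zero]
  intro x hx
  have h := congrArg WithLp.ofLp hx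
  have h1 : x a = 0 := congrArg Prod.fst h
  have h2 : x.2.2.2.toLp (deriv x) = 0 := congrArg Prod.snd h
  have h3 : deriv x =ᵐ[volume.restrict (Icc a b)] 0 :=
    x.2.2.2.coeFn_toLp.symm.trans ((Lp.eq_zero_iff_ae_eq_zero).1 h2)
  apply Subtype.ext
  funext t
  by_cases ht : t ∈ Icc a b
  · exact (ac_eq_of_deriv_eq_zero x.2.2.1 h3 t ht).trans h1
  · exact x.2.1 t ht

variable [Fact (1 ≤ p)]

/-- The norm `(‖x a‖ ^ p + ‖x'‖_{L^p} ^ p) ^ (1 / p)`; see `norm_eq`. -/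
instance : NormedAddCommGroup (Sobolev E p a b) :=
  NormedAddCommGroup.induced _ _ (toProd : Sobolev E p a b →ₗ[ℝ] _) toProd_injective

instance : NormedSpace ℝ (Sobolev E p a b) :=
  NormedSpace.induced ℝ (Sobolev E p a b) _ (toProd : Sobolev E p a b →ₗ[ℝ] _)

theorem norm_eq (hp : p ≠ ∞) (x : Sobolev E p a b) :
    ‖x‖ = (‖x a‖ ^ p.toReal + ∫ t in Icc a b, ‖deriv x t‖ ^ p.toReal) ^ (1 / p.toReal) := by
  have hp1 : (1 : ℝ≥0∞) ≤ p := Fact.out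
  have hp0 : p ≠ 0 := (zero_lt_one.trans_le hp1).ne'
  have hpos : 0 < p.toReal := ENNReal.toReal_pos hp0 hp
  have h : ‖x‖ = ‖toProd x‖ := rfl
  have hI : 0 ≤ ∫ t in Icc a b, ‖deriv x t‖ ^ p.toReal :=
    integral_nonneg fun t => by positivity
  rw [h, WithLp.prod_norm_eq_add hpos]
  congr 2
  change ‖x.2.2.2.toLp (deriv x)‖ ^ p.toReal = _
  rw [Lp.norm_toLp, x.2.2.2.eLpNorm_eq_integral_rpow_norm hp0 hp,
    ENNReal.toReal_ofReal (by positivity), ← Real.rpow_mul hI, inv_mul_cancel₀ hpos.ne',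
    Real.rpow_one]

end Sobolev

/-! ### Fréchet differentiability on sets that need not be open -/

/-- `g` is continuously Fréchet differentiable on `U`: every point of `U` is a limit point of `U`,
at every point of `U` there is exactly one bounded linear approximation `Dg` of `g` within `U`, and
`Dg` depends continuously on the point of `U` in the operator norm. -/
def ContFrechetDiffOn {X Y : Type*} [NormedAddCommGroup X] [NormedSpace ℝ X]
    [NormedAddCommGroup Y] [NormedSpace ℝ Y] (g : X → Y) (U : Set X) : Prop :=
  (∀ u ∈ U, AccPt u (𝓟 U)) ∧
  ∃ Dg : X → X →L[ℝ] Y, ContinuousOn Dg U ∧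
    ∀ u ∈ U, HasFDerivWithinAt g (Dg u) U u ∧
      ∀ A : X →L[ℝ] Y, HasFDerivWithinAt g A U u → A = Dg u

/-! ### Solutions of the initial value problem -/

/-- `x` solves `x'(t) = f (x t, x (t - r))` for `0 ≤ t < S` (with the right-hand derivative at
`t = 0`) and `x = φ` on `[-R, 0]`. Only the values of `x` on `[-R, S)` matter. -/
def IsSolution (f : E × E → E) (R r : ℝ) (φ : ℝ → E) (S : EReal) (x : ℝ → E) : Prop :=
  (∀ t ∈ Icc (-R) 0, x t = φ t) ∧
  ∀ t : ℝ, 0 ≤ t → (t : EReal) < S → HasDerivWithinAt x (f (x t, x (t - r))) (Ici 0) t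

/-- `x`, regarded as a function on `[-R, S)` with `0 < S ≤ ∞`, is the unique maximal solution of
the initial value problem: it is a solution, and every other solution is a restriction of it. -/
def IsMaximalSolution (f : E × E → E) (R r : ℝ) (φ : ℝ → E) (S : EReal) (x : ℝ → E) : Prop :=
  0 < S ∧ IsSolution f R r φ S x ∧
  ∀ (S' : EReal) (z : ℝ → E), IsSolution f R r φ S' z →
    S' ≤ S ∧ ∀ t : ℝ, -R ≤ t → (t : EReal) < S' → z t = x t

end DelayEq

end

/-!
The delay equation is turned into a fixed point equation for the derivative of the solution, and the
uniform contraction principle is applied to it.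

A function on `[-R, T]` in `W^{1,p}` is the same as its value `c` at `-R` together with its
derivative in `L^p` (`sobolevEquiv`). Extending derivatives by zero, one may work with pairs `(c, w)`
in `E × L^p(ℝ, E)` and their primitives `x t = c + ∫_{-R}^t w`. If `w` is glued from the derivative
of the history `φ` on `[-R, 0]` and an unknown `y` on `[0, T]`, the equation reads
`y = g (x ·, x (· - r))` in `L^p([0, T], E)`. Here `g` is a `C¹` map that is bounded and globally
Lipschitz and agrees with `f` on a ball which the solutions starting in `B` do not leave up to the
time `T`; this is where the boundedness of `B` in the supremum norm enters. For small `T` the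
right-hand side is a contraction in `y`, uniformly in `φ` and `r`. Since primitives are defined on
the whole line, `r` may be any real number, so the parameter set has no boundary and the end points
`r = 0` and `r = R` need no separate treatment.

It remains to see that the right-hand side is `C¹` in `(φ, r, y)` with values in `L^p`. There are two
points. The delayed primitive `x (· - r)`, as an element of `L^p`, is `C¹` in `(c, w, r)`
(`contDiff_delayed`): its derivative in `r` is `-w (· - r)`, because difference quotients of a
primitive are averages of translates, and translations are continuous in `L^p` for `p < ∞`. The
superposition with `g` is not differentiable on `L^p`, but it is so along a family that is `C¹` in
`L^p` and whose values are jointly continuous (`contDiff_superposition`).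

The uniqueness of solutions, and hence the existence of the maximal one, comes from a weighted
supremum norm estimate (`IsSolution.eq_of_lt`). Finally, the derivative within `B × [0, R]` is unique
because this is the product of an open set and a nondegenerate interval.
-/

noncomputable section

namespace DelayEq

/-! ### The uniform contraction principle -/

/-- The fixed points of a uniform contraction that is `C¹` jointly in the parameter and the point
depend on the parameter in a `C¹` way: they are continuous in the parameter, hence locally equal to
the implicit function of `y - G (u, y) = 0`. -/
theorem exists_contDiff_fixedPoint {P Y : Type*} [NormedAddCommGroup P] [NormedSpace ℝ P]
    [CompleteSpace P] [NormedAddCommGroup Y] [NormedSpace ℝ Y] [CompleteSpace Y]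
    {G : P × Y → Y} (hG : ContDiff ℝ 1 G) {K : NNReal} (hK : K < 1)
    (hL : ∀ u, LipschitzWith K fun y => G (u, y)) :
    ∃ y : P → Y, ContDiff ℝ 1 y ∧ ∀ u, G (u, y u) = y u := by
  have hC (u : P) : ContractingWith K fun y => G (u, y) := ⟨hK, hL u⟩
  set y : P → Y := fun u => (hC u).fixedPoint _ with hy
  have hfix (u : P) : G (u, y u) = y u := (hC u).fixedPoint_isFixedPt
  have hcont : Continuous y := by
    rw [continuous_iff_continuousAt]
    intro u₀
    rw [ContinuousAt, tendsto_iff_dist_tendsto_zero]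
    have h1 : Tendsto (fun u => dist (y u₀) (G (u, y u₀)) / (1 - K)) (𝓝 u₀) (𝓝 0) := by
      have h2 : Continuous fun u => dist (y u₀) (G (u, y u₀)) / (1 - K) := by
        have := hG.continuous
        fun_prop
      have h3 := h2.tendsto u₀
      rwa [hfix u₀, dist_self, zero_div] at h3
    refine squeeze_zero (fun _ => dist_nonneg) (fun u => ?_) h1
    rw [dist_comm]
    exact (hC u).dist_le_of_fixedPoint _ (hfix u)
  refine ⟨y, contDiff_iff_contDiffAt.2 fun u₀ => ?_, hfix⟩
  set F : P × Y → Y := fun q => q.2 - G q with hF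
  have hFc : ContDiff ℝ 1 F := contDiff_snd.sub hG
  have hFat : ContDiffAt ℝ 1 F (u₀, y u₀) := hFc.contDiffAt
  have hGd : HasFDerivAt G (fderiv ℝ G (u₀, y u₀)) (u₀, y u₀) :=
    (hG.differentiable one_ne_zero _).hasFDerivAt
  have hFd : fderiv ℝ F (u₀, y u₀) = ContinuousLinearMap.snd ℝ P Y - fderiv ℝ G (u₀, y u₀) :=
    (hasFDerivAt_snd.sub hGd).fderiv
  have hpart : ‖fderiv ℝ G (u₀, y u₀) ∘L .inr ℝ P Y‖ ≤ K := by
    have h1 : HasFDerivAt (fun z : Y => G (u₀, z)) (fderiv ℝ G (u₀, y u₀) ∘L .inr ℝ P Y) (y u₀) :=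
      hGd.comp (y u₀) (hasFDerivAt_prodMk_right u₀ (y u₀))
    exact h1.le_of_lipschitz (hL u₀)
  -- The partial derivative in `y` is `1 - ∂G/∂y` with `‖∂G/∂y‖ ≤ K < 1`.
  have hinv : (fderiv ℝ F (u₀, y u₀) ∘L .inr ℝ P Y).IsInvertible := by
    have h1 : fderiv ℝ F (u₀, y u₀) ∘L .inr ℝ P Y = 1 - fderiv ℝ G (u₀, y u₀) ∘L .inr ℝ P Y := by
      rw [hFd]
      ext z
      simp
    rw [h1]
    have h2 : ‖fderiv ℝ G (u₀, y u₀) ∘L .inr ℝ P Y‖ < 1 := hpart.trans_lt (by exact_mod_cast hK)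
    have h3 := isUnit_one_sub_of_norm_lt_one h2
    obtain ⟨e, he⟩ := h3
    exact ⟨ContinuousLinearEquiv.unitsEquiv ℝ Y e, he⟩
  have hψ := hFat.contDiffAt_implicitFunction one_ne_zero hinv
  refine hψ.congr_of_eventuallyEq ?_
  have hev := hFat.eventually_apply_eq_iff_implicitFunction one_ne_zero hinv
  have ht : Tendsto (fun u => (u, y u)) (𝓝 u₀) (𝓝 (u₀, y u₀)) :=
    (continuous_id.prodMk hcont).tendsto u₀
  filter_upwards [ht.eventually hev] with u hu
  exact (hu.1 (by simp [hF, hfix])).symm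

/-! ### Superposition operators -/

/-- A superposition operator `z ↦ g ∘ v z` is `C¹` into `L^p` when `g` is `C¹`, `z ↦ v z` is `C¹`
into `L^p`, and the values `v z t` depend continuously on `(z, t)`. Continuity of the values is
needed since a superposition operator is in general not differentiable from `L^p` to `L^p`. -/
theorem contDiff_superposition {Z F G : Type*} [NormedAddCommGroup Z] [NormedSpace ℝ Z]
    [NormedAddCommGroup F] [NormedSpace ℝ F] [NormedAddCommGroup G] [NormedSpace ℝ G]
    {p : ℝ≥0∞} [Fact (1 ≤ p)] {α : Type*} [TopologicalSpace α] [MeasurableSpace α]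
    {μ : Measure α} [IsFiniteMeasure μ] {K : Set α} (hK : IsCompact K) (hμK : ∀ᵐ t ∂μ, t ∈ K)
    {g : F → G} (hg : ContDiff ℝ 1 g) {v : Z → α → F} (hv : Continuous (Function.uncurry v))
    {vbar : Z → Lp F p μ} (hvbar : ContDiff ℝ 1 vbar) (hvv : ∀ z, vbar z =ᵐ[μ] v z)
    {n : Z → Lp G p μ} (hn : ∀ z, n z =ᵐ[μ] fun t => g (v z t)) : ContDiff ℝ 1 n := by
  have hgd (x : F) : HasStrictFDerivAt g (fderiv ℝ g x) x :=
    hg.contDiffAt.hasStrictFDerivAt one_ne_zero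
  have hDg : Continuous (fderiv ℝ g) := hg.continuous_fderiv one_ne_zero
  have hvz (z : Z) : Continuous (v z) := hv.comp (by fun_prop : Continuous fun t => (z, t))
  have hmeas (z : Z) : AEStronglyMeasurable (fun t => fderiv ℝ g (v z t)) μ :=
    hDg.comp_aestronglyMeasurable ((Lp.aestronglyMeasurable (vbar z)).congr (hvv z))
  have hA (z : Z) : MemLp (fun t => fderiv ℝ g (v z t)) ∞ μ := by
    obtain ⟨C, hC⟩ := hK.exists_bound_of_continuousOn
      (hDg.comp (hvz z)).continuousOn
    exact memLp_top_of_bound (hmeas z) C (hμK.mono fun t ht => hC t ht)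
  set A : Z → Lp (F →L[ℝ] G) ∞ μ := fun z => (hA z).toLp _ with hAdef
  have hAc : Continuous A := by
    rw [Metric.continuous_iff']
    intro z₀ ε hε
    have h1 : ∀ᶠ z in 𝓝 z₀, ∀ t ∈ K, ‖fderiv ℝ g (v z t) - fderiv ℝ g (v z₀ t)‖ < ε / 2 := by
      refine hK.eventually_forall_of_forall_eventually fun t _ => ?_
      have h2 : Continuous fun q : Z × α =>
          ‖fderiv ℝ g (v q.1 q.2) - fderiv ℝ g (v z₀ q.2)‖ := by
        have h3 : Continuous fun q : Z × α => v q.1 q.2 := hv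
        have h4 : Continuous fun q : Z × α => v z₀ q.2 := (hvz z₀).comp continuous_snd
        exact ((hDg.comp h3).sub (hDg.comp h4)).norm
      exact (h2.tendsto (z₀, t)).eventually_lt_const (by simpa using half_pos hε)
    filter_upwards [h1] with z hz
    rw [dist_eq_norm]
    have h2 : ∀ᵐ t ∂μ, ‖(A z - A z₀) t‖ ≤ ε / 2 := by
      filter_upwards [hμK, Lp.coeFn_sub (A z) (A z₀), (hA z).coeFn_toLp, (hA z₀).coeFn_toLp]
        with t k1 k2 k3 k4
      rw [k2, Pi.sub_apply, k3, k4]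
      exact (hz t k1).le
    refine (Lp.norm_le_of_ae_bound (half_pos hε).le h2).trans_lt ?_
    simpa using hε
  set M := (ContinuousLinearMap.id ℝ (F →L[ℝ] G)).holderL μ ∞ p p with hM
  rw [contDiff_one_iff_hasFDerivAt]
  refine ⟨fun z => (M (A z)) ∘L (fderiv ℝ vbar z), ?_, fun z₀ => ?_⟩
  · have := hvbar.continuous_fderiv one_ne_zero
    exact (M.continuous.comp hAc).clm_comp this
  have hvd : HasFDerivAt vbar (fderiv ℝ vbar z₀) z₀ :=
    (hvbar.differentiable one_ne_zero z₀).hasFDerivAt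
  -- The remainder is small relative to `vbar z - vbar z₀` in `L^p` because the first-order
  -- expansion of `g` at `v z₀ t` holds uniformly for `t` in the compact set `K`.
  have hlin : (fun z => n z - n z₀ - M (A z₀) (vbar z - vbar z₀)) =o[𝓝 z₀]
      fun z => vbar z - vbar z₀ := by
    rw [Asymptotics.isLittleO_iff]
    intro ε hε
    have h1 : ∀ᶠ z in 𝓝 z₀, ∀ t ∈ K, ‖g (v z t) - g (v z₀ t) -
        fderiv ℝ g (v z₀ t) (v z t - v z₀ t)‖ ≤ ε * ‖v z t - v z₀ t‖ := by
      refine hK.eventually_forall_of_forall_eventually fun t _ => ?_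
      have h3 : Continuous fun q : Z × α => v q.1 q.2 := hv
      have h4 : Continuous fun q : Z × α => v z₀ q.2 := (hvz z₀).comp continuous_snd
      have h5 := ((h3.prodMk h4).tendsto (z₀, t)).eventually
        ((hasStrictFDerivAt_iff_isLittleO.1 (hgd (v z₀ t))).def (half_pos hε))
      have h6 : ∀ᶠ q : Z × α in 𝓝 (z₀, t),
          ‖fderiv ℝ g (v z₀ q.2) - fderiv ℝ g (v z₀ t)‖ < ε / 2 :=
        (((hDg.comp h4).sub continuous_const).norm.tendsto (z₀, t)).eventually_lt_const
          (by simpa using half_pos hε)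
      filter_upwards [h5, h6] with q h7 h8
      have h9 := (fderiv ℝ g (v z₀ q.2) - fderiv ℝ g (v z₀ t)).le_of_opNorm_le h8.le
        (v q.1 q.2 - v z₀ q.2)
      calc _ = ‖(g (v q.1 q.2) - g (v z₀ q.2) - fderiv ℝ g (v z₀ t) (v q.1 q.2 - v z₀ q.2)) -
            (fderiv ℝ g (v z₀ q.2) - fderiv ℝ g (v z₀ t)) (v q.1 q.2 - v z₀ q.2)‖ := by
              congr 1
              simp only [sub_apply]
              abel
        _ ≤ ε / 2 * ‖v q.1 q.2 - v z₀ q.2‖ + ε / 2 * ‖v q.1 q.2 - v z₀ q.2‖ :=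
              (norm_sub_le _ _).trans (add_le_add h7 h9)
        _ = _ := by ring
    filter_upwards [h1] with z hz
    refine Lp.norm_le_mul_norm_of_ae_le_mul ?_
    have h10 : M (A z₀) (vbar z - vbar z₀) =ᵐ[μ] fun t => (A z₀ t) ((vbar z - vbar z₀) t) :=
      ContinuousLinearMap.coeFn_holder (r := p) _ (A z₀) (vbar z - vbar z₀)
    filter_upwards [hμK, Lp.coeFn_sub (n z - n z₀) (M (A z₀) (vbar z - vbar z₀)),
      Lp.coeFn_sub (n z) (n z₀), Lp.coeFn_sub (vbar z) (vbar z₀), hn z, hn z₀, hvv z, hvv z₀,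
      h10, (hA z₀).coeFn_toLp] with t k1 k2 k3 k4 k5 k6 k7 k8 k9 k10
    rw [k2, Pi.sub_apply, k3, Pi.sub_apply, k9, k4, Pi.sub_apply, k5, k6, k7, k8, hAdef, k10]
    exact hz t k1
  rw [hasFDerivAt_iff_isLittleO]
  have h1 := hlin.trans_isBigO hvd.isBigO_sub
  have h2 := ((M (A z₀)).isBigO_comp _ _).trans_isLittleO (hasFDerivAt_iff_isLittleO.1 hvd)
  refine (h1.add h2).congr_left fun z => ?_
  simp

/-! ### Cutting off a `C¹` map -/

/-- On every ball, a `C¹` map agrees with a bounded and globally Lipschitz `C¹` map. -/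
theorem exists_contDiff_lipschitzWith_bounded_eqOn_closedBall {F G : Type*} [NormedAddCommGroup F]
    [NormedSpace ℝ F] [FiniteDimensional ℝ F] [NormedAddCommGroup G] [NormedSpace ℝ G]
    {f : F → G} (hf : ContDiff ℝ 1 f) (ρ : ℝ) :
    ∃ (g : F → G) (L : NNReal) (K : ℝ), ContDiff ℝ 1 g ∧ LipschitzWith L g ∧ (∀ x, ‖g x‖ ≤ K) ∧
      ∀ x, ‖x‖ ≤ ρ → g x = f x := by
  let χ : ContDiffBump (0 : F) := ⟨|ρ| + 1, |ρ| + 2, by positivity, by linarith⟩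
  have hχ : ContDiff ℝ 1 χ := χ.contDiff
  have hg : ContDiff ℝ 1 fun x => χ x • f x := hχ.smul hf
  have hs : HasCompactSupport fun x => χ x • f x := χ.hasCompactSupport.smul_right
  obtain ⟨L, hL⟩ := hg.lipschitzWith_of_hasCompactSupport hs one_ne_zero
  obtain ⟨K, hK⟩ := hs.exists_bound_of_continuous hg.continuous
  refine ⟨_, L, K, hg, hL, hK, fun x hx => ?_⟩
  have : χ x = 1 := χ.one_of_mem_closedBall (by
    rw [mem_closedBall_zero_iff]
    exact (hx.trans (le_abs_self ρ)).trans (by simp [χ]))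
  simp [this]

/-! ### Integral inequalities in `L^p` -/

section Integral

variable {α : Type*} [MeasurableSpace α] {F : Type*} [NormedAddCommGroup F] {p : ℝ≥0∞}

theorem integral_norm_le_of_memLp {ν : Measure α} [IsFiniteMeasure ν] (hp1 : 1 ≤ p) {u : α → F}
    (hu : MemLp u p ν) :
    ∫ s, ‖u s‖ ∂ν ≤ (1 + ν.real univ) * (eLpNorm u p ν).toReal := by
  have h1 := eLpNorm_le_eLpNorm_mul_rpow_measure_univ hp1 hu.1
  have hθ0 : 0 ≤ 1 / (1 : ℝ≥0∞).toReal - 1 / p.toReal := by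
    rcases eq_or_ne p ∞ with rfl | hp
    · simp
    · have : 1 ≤ p.toReal := by
        rw [← ENNReal.toReal_one]
        exact ENNReal.toReal_mono hp hp1
      simp only [ENNReal.toReal_one, one_div, inv_one, sub_nonneg]
      exact inv_le_one_of_one_le₀ this
  have hθ1 : 1 / (1 : ℝ≥0∞).toReal - 1 / p.toReal ≤ 1 := by
    have : 0 ≤ 1 / p.toReal := by positivity
    simp only [ENNReal.toReal_one, div_one]
    linarith
  have h2 : ν univ ^ (1 / (1 : ℝ≥0∞).toReal - 1 / p.toReal) ≤ 1 + ν univ := by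
    rcases le_total (ν univ) 1 with h | h
    · exact (ENNReal.rpow_le_one h hθ0).trans le_self_add
    · refine (ENNReal.rpow_le_rpow_of_exponent_le h hθ1).trans ?_
      rw [ENNReal.rpow_one]
      exact le_add_self
  have h3 : eLpNorm u 1 ν ≤ eLpNorm u p ν * (1 + ν univ) := h1.trans (by gcongr)
  have h4 : (eLpNorm u 1 ν).toReal ≤ (eLpNorm u p ν * (1 + ν univ)).toReal :=
    ENNReal.toReal_mono (ENNReal.mul_ne_top hu.2.ne
      (ENNReal.add_ne_top.2 ⟨ENNReal.one_ne_top, measure_ne_top _ _⟩)) h3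
  rw [integral_norm_eq_lintegral_enorm hu.1, ← eLpNorm_one_eq_lintegral_enorm]
  refine h4.trans_eq ?_
  rw [ENNReal.toReal_mul, ENNReal.toReal_add ENNReal.one_ne_top (measure_ne_top _ _),
    ENNReal.toReal_one, mul_comm]
  rfl

/-- Minkowski's integral inequality, in the weak form where the `L^p` norms of the sections are
bounded by a constant. Hölder's inequality in `s` for each `t` is followed by Tonelli's theorem. -/
theorem eLpNorm_integral_le_of_forall_eLpNorm_le [NormedSpace ℝ F] {β : Type*} [MeasurableSpace β]
    {μ : Measure α} [SFinite μ] {ν : Measure β} [IsFiniteMeasure ν] (hp1 : 1 ≤ p) (hp : p ≠ ∞)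
    {g : α → β → F} (hg : StronglyMeasurable (Function.uncurry g)) {C : ℝ≥0∞}
    (hC : ∀ᵐ s ∂ν, eLpNorm (fun t => g t s) p μ ≤ C) :
    eLpNorm (fun t => ∫ s, g t s ∂ν) p μ ≤ ν univ * C := by
  have hp0 : p ≠ 0 := (zero_lt_one.trans_le hp1).ne'
  have hq1 : 1 ≤ p.toReal := by
    rw [← ENNReal.toReal_one]
    exact ENNReal.toReal_mono hp hp1
  have hq0 : 0 < p.toReal := zero_lt_one.trans_le hq1
  set q := p.toReal with hq
  have hgt (t : α) : AEStronglyMeasurable (g t) ν :=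
    (hg.comp_measurable (measurable_const.prodMk measurable_id)).aestronglyMeasurable
  have hpt (t : α) : ‖∫ s, g t s ∂ν‖ₑ ^ q ≤ (∫⁻ s, ‖g t s‖ₑ ^ q ∂ν) * ν univ ^ (q - 1) := by
    have h1 := eLpNorm'_le_eLpNorm'_mul_rpow_measure_univ zero_lt_one hq1 (hgt t)
    simp only [eLpNorm'_eq_lintegral_enorm, ENNReal.rpow_one, div_one] at h1
    calc ‖∫ s, g t s ∂ν‖ₑ ^ q ≤ (∫⁻ s, ‖g t s‖ₑ ∂ν) ^ q := by
          gcongr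
          exact enorm_integral_le_lintegral_enorm _
      _ ≤ ((∫⁻ s, ‖g t s‖ₑ ^ q ∂ν) ^ (1 / q) * ν univ ^ (1 - 1 / q)) ^ q := by gcongr
      _ = _ := by
          rw [ENNReal.mul_rpow_of_nonneg _ _ hq0.le, ← ENNReal.rpow_mul, ← ENNReal.rpow_mul,
            one_div, inv_mul_cancel₀ hq0.ne', ENNReal.rpow_one, sub_mul, inv_mul_cancel₀ hq0.ne',
            one_mul]
  have hsec : ∀ᵐ s ∂ν, ∫⁻ t, ‖g t s‖ₑ ^ q ∂μ ≤ C ^ q := by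
    filter_upwards [hC] with s hs
    rw [eLpNorm_eq_lintegral_rpow_enorm_toReal hp0 hp, one_div] at hs
    exact (ENNReal.rpow_inv_le_iff hq0).1 hs
  have hmeas : Measurable (Function.uncurry fun t s => ‖g t s‖ₑ ^ q) :=
    hg.enorm.pow_const q
  rw [eLpNorm_eq_lintegral_rpow_enorm_toReal hp0 hp, one_div, ← hq, ENNReal.rpow_inv_le_iff hq0]
  calc ∫⁻ t, ‖∫ s, g t s ∂ν‖ₑ ^ q ∂μ
      ≤ ∫⁻ t, (∫⁻ s, ‖g t s‖ₑ ^ q ∂ν) * ν univ ^ (q - 1) ∂μ := lintegral_mono hpt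
    _ = (∫⁻ s, ∫⁻ t, ‖g t s‖ₑ ^ q ∂μ ∂ν) * ν univ ^ (q - 1) := by
        rw [lintegral_mul_const' _ _ (ENNReal.rpow_ne_top_of_nonneg (by linarith)
          (measure_ne_top _ _)), lintegral_lintegral_swap hmeas.aemeasurable]
    _ ≤ (C ^ q * ν univ) * ν univ ^ (q - 1) := by
        gcongr
        rw [← lintegral_const]
        exact lintegral_mono_ae hsec
    _ = (ν univ * C) ^ q := by
        rw [ENNReal.mul_rpow_of_nonneg _ _ hq0.le, mul_assoc, mul_comm]
        congr 1
        rcases eq_or_ne (ν univ) 0 with h | h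
        · simp [h, hq0]
        · conv_lhs => rw [← ENNReal.rpow_one (ν univ)]
          rw [← ENNReal.rpow_mul, one_mul, ← ENNReal.rpow_add _ _ h (measure_ne_top _ _)]
          congr 1
          ring

end Integral

/-! ### Primitives of `L^p` functions -/

section Primitive

instance isFiniteMeasure_restrict_uIoc (a b : ℝ) : IsFiniteMeasure (volume.restrict (uIoc a b)) :=
  inferInstanceAs (IsFiniteMeasure (volume.restrict (Ioc (min a b) (max a b))))

theorem intervalIntegrable_Lp {E : Type*} [NormedAddCommGroup E] {p : ℝ≥0∞} [Fact (1 ≤ p)]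
    (w : Lp E p (volume : Measure ℝ)) (a b : ℝ) :
    IntervalIntegrable w volume a b := by
  rw [intervalIntegrable_iff]
  exact ((Lp.memLp w).restrict _).integrable Fact.out

variable {E : Type*} [NormedAddCommGroup E] [NormedSpace ℝ E] {p : ℝ≥0∞}

/-- The function `t ↦ c + ∫_a^t w` for `v = (c, w)` in `E × L^p(ℝ, E)`. -/
def primitive (a : ℝ) (v : E × Lp E p (volume : Measure ℝ)) (t : ℝ) : E :=
  v.1 + ∫ s in a..t, v.2 s

theorem primitive_smul (a c : ℝ) (v : E × Lp E p (volume : Measure ℝ)) (t : ℝ) :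
    primitive a (c • v) t = c • primitive a v t := by
  have h : ∫ s in a..t, (c • v.2) s = c • ∫ s in a..t, v.2 s := by
    rw [← intervalIntegral.integral_smul]
    refine intervalIntegral.integral_congr_ae ?_
    filter_upwards [Lp.coeFn_smul c v.2] with s hs _ using hs
  simp only [primitive, Prod.smul_fst, Prod.smul_snd, h, smul_add]

variable [Fact (1 ≤ p)]

theorem primitive_add (a : ℝ) (v v' : E × Lp E p (volume : Measure ℝ)) (t : ℝ) :
    primitive a (v + v') t = primitive a v t + primitive a v' t := by
  have h : ∫ s in a..t, (v.2 + v'.2) s = (∫ s in a..t, v.2 s) + ∫ s in a..t, v'.2 s := by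
    rw [← intervalIntegral.integral_add (intervalIntegrable_Lp _ _ _)
      (intervalIntegrable_Lp _ _ _)]
    refine intervalIntegral.integral_congr_ae ?_
    filter_upwards [Lp.coeFn_add v.2 v'.2] with s hs _ using hs
  simp only [primitive, Prod.fst_add, Prod.snd_add, h]
  abel

theorem primitive_sub (a : ℝ) (v v' : E × Lp E p (volume : Measure ℝ)) (t : ℝ) :
    primitive a (v - v') t = primitive a v t - primitive a v' t := by
  rw [eq_sub_iff_add_eq, ← primitive_add, sub_add_cancel]

theorem norm_primitive_le (a : ℝ) (v : E × Lp E p (volume : Measure ℝ)) (t : ℝ) :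
    ‖primitive a v t‖ ≤ (2 + |t - a|) * ‖v‖ := by
  have h1 : ‖∫ s in a..t, v.2 s‖ ≤ (1 + |t - a|) * ‖v.2‖ := by
    refine intervalIntegral.norm_integral_le_integral_norm_uIoc.trans ?_
    refine (integral_norm_le_of_memLp Fact.out ((Lp.memLp v.2).restrict _)).trans ?_
    rw [measureReal_restrict_apply_univ, measureReal_def, Real.volume_uIoc,
      ENNReal.toReal_ofReal (abs_nonneg _), Lp.norm_def]
    gcongr
    · exact Lp.eLpNorm_ne_top _
    · exact Measure.restrict_le_self
  have h2 : ‖v.1‖ ≤ ‖v‖ := norm_fst_le v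
  have h3 : ‖v.2‖ ≤ ‖v‖ := norm_snd_le v
  calc ‖primitive a v t‖ ≤ ‖v.1‖ + ‖∫ s in a..t, v.2 s‖ := norm_add_le _ _
    _ ≤ ‖v‖ + (1 + |t - a|) * ‖v‖ := by
        gcongr
        exact h1.trans (by gcongr)
    _ = _ := by ring

theorem continuous_primitive_right (a : ℝ) (v : E × Lp E p (volume : Measure ℝ)) :
    Continuous (primitive a v) :=
  continuous_const.add
    (intervalIntegral.continuous_primitive (fun b c => intervalIntegrable_Lp v.2 b c) a)

theorem continuous_primitive (a : ℝ) :
    Continuous fun q : (E × Lp E p (volume : Measure ℝ)) × ℝ => primitive a q.1 q.2 := by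
  rw [continuous_iff_continuousAt]
  rintro ⟨v₀, t₀⟩
  have h1 : Tendsto (fun q : (E × Lp E p (volume : Measure ℝ)) × ℝ => primitive a (q.1 - v₀) q.2)
      (𝓝 (v₀, t₀)) (𝓝 0) := by
    refine squeeze_zero_norm (fun q => norm_primitive_le a _ _) ?_
    have h2 : Continuous fun q : (E × Lp E p (volume : Measure ℝ)) × ℝ =>
      (2 + |q.2 - a|) * ‖q.1 - v₀‖ := by fun_prop
    simpa using h2.tendsto (v₀, t₀)
  have h3 : Tendsto (fun q : (E × Lp E p (volume : Measure ℝ)) × ℝ => primitive a v₀ q.2)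
      (𝓝 (v₀, t₀)) (𝓝 (primitive a v₀ t₀)) :=
    ((continuous_primitive_right a v₀).comp continuous_snd).tendsto (v₀, t₀)
  have h4 := h1.add h3
  rw [zero_add] at h4
  refine h4.congr fun q => ?_
  rw [← primitive_add, sub_add_cancel]

/-- Translation `w ↦ w (· - r)` as an isometry of `L^p(ℝ, E)`. -/
def translate (r : ℝ) : Lp E p (volume : Measure ℝ) →ₗᵢ[ℝ] Lp E p (volume : Measure ℝ) :=
  Lp.compMeasurePreservingₗᵢ ℝ (fun t => t - r) (measurePreserving_sub_right volume r)

theorem coeFn_translate (r : ℝ) (w : Lp E p (volume : Measure ℝ)) :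
    translate r w =ᵐ[volume] fun t => w (t - r) :=
  Lp.coeFn_compMeasurePreserving w (measurePreserving_sub_right volume r)

theorem continuous_translate (hp : p ≠ ∞) :
    Continuous fun q : Lp E p (volume : Measure ℝ) × ℝ => translate q.2 q.1 := by
  let g : Lp E p (volume : Measure ℝ) × ℝ → C(ℝ, ℝ) :=
    fun q => ⟨fun t => t - q.2, by fun_prop⟩
  have hg : Continuous g := ContinuousMap.continuous_of_continuous_uncurry _ (by
    change Continuous fun x : (Lp E p (volume : Measure ℝ) × ℝ) × ℝ => x.2 - x.1.2
    fun_prop)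
  exact Continuous.compMeasurePreservingLp continuous_fst hg
    (fun q => measurePreserving_sub_right volume q.2) hp

end Primitive

/-! ### The delayed primitive as a map into `L^p` -/

section Delay

theorem memLp_restrict_Icc_of_continuous {F : Type*} [NormedAddCommGroup F] {p : ℝ≥0∞} {a b : ℝ}
    {f : ℝ → F} (hf : Continuous f) : MemLp f p (volume.restrict (Icc a b)) := by
  obtain ⟨C, hC⟩ := isCompact_Icc.exists_bound_of_continuousOn (hf.continuousOn (s := Icc a b))
  refine MemLp.of_bound hf.aestronglyMeasurable C ?_
  exact (ae_restrict_mem measurableSet_Icc).mono fun t ht => hC t ht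

variable {E : Type*} [NormedAddCommGroup E] [NormedSpace ℝ E] {p : ℝ≥0∞} [Fact (1 ≤ p)]

theorem memLp_primitive_delay (a T r : ℝ) (v : E × Lp E p (volume : Measure ℝ)) :
    MemLp (fun t => primitive a v (t - r)) p (volume.restrict (Icc 0 T)) :=
  memLp_restrict_Icc_of_continuous ((continuous_primitive_right a v).comp (by fun_prop))

/-- The bounded linear map that sends `v` to the restriction to `[0, T]` of the delayed primitive
`t ↦ primitive a v (t - r)`, as an element of `L^p`. -/
def delayed (a T r : ℝ) :
    E × Lp E p (volume : Measure ℝ) →L[ℝ] Lp E p (volume.restrict (Icc 0 T)) :=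
  LinearMap.mkContinuous
    { toFun := fun v => (memLp_primitive_delay a T r v).toLp _
      map_add' := fun v v' => by
        rw [← MemLp.toLp_add]
        exact MemLp.toLp_congr _ _ (ae_of_all _ fun t => primitive_add a v v' _)
      map_smul' := fun c v => by
        rw [RingHom.id_apply, ← MemLp.toLp_const_smul]
        exact MemLp.toLp_congr _ _ (ae_of_all _ fun t => primitive_smul a c v _) }
    ((measureUnivNNReal (volume.restrict (Icc 0 T)) : ℝ) ^ p.toReal⁻¹ * (2 + (|T| + |r| + |a|)))
    (fun v => by
      rw [mul_assoc]
      refine Lp.norm_le_of_ae_bound (by positivity) ?_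
      filter_upwards [ae_restrict_mem measurableSet_Icc, 
        (memLp_primitive_delay a T r v).coeFn_toLp] with t ht h
      change ‖(memLp_primitive_delay a T r v).toLp _ t‖ ≤ _
      rw [h]
      refine (norm_primitive_le a v _).trans ?_
      gcongr
      have h1 : |t| ≤ |T| := by
        rw [abs_of_nonneg ht.1]
        exact ht.2.trans (le_abs_self T)
      calc |t - r - a| ≤ |t - r| + |a| := abs_sub _ _
        _ ≤ |t| + |r| + |a| := by gcongr; exact abs_sub _ _
        _ ≤ _ := by gcongr)

theorem coeFn_delayed (a T r : ℝ) (v : E × Lp E p (volume : Measure ℝ)) :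
    delayed a T r v =ᵐ[volume.restrict (Icc 0 T)] fun t => primitive a v (t - r) :=
  (memLp_primitive_delay a T r v).coeFn_toLp

variable [CompleteSpace E]

/-- In `L^p`, the derivative of a delayed primitive with respect to the delay is minus the
translated integrand. Pointwise in `t` this can fail. -/
theorem hasDerivAt_delayed (hp : p ≠ ∞) (a T : ℝ) (v : E × Lp E p (volume : Measure ℝ)) (r₀ : ℝ) :
    HasDerivAt (fun r => delayed a T r v)
      (-(LpToLpRestrictCLM ℝ E ℝ volume p (Icc 0 T) (translate r₀ v.2))) r₀ := by
  set ρ := LpToLpRestrictCLM ℝ E ℝ volume p (Icc 0 T)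
  set w := v.2 with hw
  rw [hasDerivAt_iff_isLittleO, Asymptotics.isLittleO_iff]
  intro ε hε
  have hcont : Continuous fun s => ‖translate s w - translate r₀ w‖ := by
    have h1 : Continuous fun s : ℝ => translate s w :=
      (continuous_translate hp).comp (by fun_prop : Continuous fun s : ℝ => (w, s))
    exact (h1.sub continuous_const).norm
  have hev : ∀ᶠ s in 𝓝 r₀, ‖translate s w - translate r₀ w‖ < ε :=
    (hcont.tendsto r₀).eventually_lt_const (by simpa using hε)
  obtain ⟨δ, hδ, hball⟩ := Metric.eventually_nhds_iff_ball.1 hev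
  filter_upwards [Metric.ball_mem_nhds r₀ hδ] with r hr
  -- The remainder is an average of differences of translates, to which Minkowski's inequality
  -- applies.
  have hpt : ∀ t, primitive a v (t - r) - primitive a v (t - r₀) - (r - r₀) • (-(w (t - r₀))) =
      -∫ s in r₀..r, (w (t - s) - w (t - r₀)) := by
    intro t
    have h1 : IntervalIntegrable (fun s => w (t - s)) volume r₀ r := by
      simpa using (intervalIntegrable_Lp w (t - r₀) (t - r)).comp_sub_left t
    rw [intervalIntegral.integral_sub h1 intervalIntegrable_const,
      intervalIntegral.integral_comp_sub_left, intervalIntegral.integral_const]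
    have h2 : primitive a v (t - r₀) - primitive a v (t - r) = ∫ s in (t - r)..(t - r₀), w s := by
      simp only [primitive, add_sub_add_left_eq_sub]
      exact intervalIntegral.integral_interval_sub_left (intervalIntegrable_Lp _ _ _)
        (intervalIntegrable_Lp _ _ _)
    rw [← h2]
    simp only [smul_neg]
    abel
  have hae : (delayed a T r v - delayed a T r₀ v - (r - r₀) • (-(ρ (translate r₀ w))) :
      Lp E p (volume.restrict (Icc 0 T))) =ᵐ[volume.restrict (Icc 0 T)]
      fun t => -∫ s in r₀..r, (w (t - s) - w (t - r₀)) := by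
    filter_upwards [Lp.coeFn_sub (delayed a T r v - delayed a T r₀ v)
        ((r - r₀) • (-(ρ (translate r₀ w)))), Lp.coeFn_sub (delayed a T r v) (delayed a T r₀ v),
      Lp.coeFn_smul (r - r₀) (-(ρ (translate r₀ w))), Lp.coeFn_neg (ρ (translate r₀ w)),
      LpToLpRestrictCLM_coeFn ℝ (Icc 0 T) (translate r₀ w),
      ae_restrict_of_ae (coeFn_translate r₀ w), coeFn_delayed a T r v, coeFn_delayed a T r₀ v]
      with t h1 h2 h3 h4 h5 h6 h7 h8
    rw [h1, Pi.sub_apply, h2, Pi.sub_apply, h3, Pi.smul_apply, h4, Pi.neg_apply, h5, h6, h7, h8,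
      hpt]
  have hbound : eLpNorm (fun t => ∫ s, (w (t - s) - w (t - r₀)) ∂(volume.restrict (uIoc r₀ r))) p
      (volume.restrict (Icc 0 T)) ≤
      (volume.restrict (uIoc r₀ r)) univ * ENNReal.ofReal ε := by
    refine eLpNorm_integral_le_of_forall_eLpNorm_le Fact.out hp ?_ ?_
    · have hsm := Lp.stronglyMeasurable w
      exact (hsm.comp_measurable (measurable_fst.sub measurable_snd)).sub
        (hsm.comp_measurable (measurable_fst.sub_const r₀))
    · filter_upwards [ae_restrict_mem measurableSet_uIoc] with s hs
      have hs' : s ∈ Metric.ball r₀ δ := by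
        rw [Metric.mem_ball, Real.dist_eq] at hr ⊢
        exact (abs_sub_left_of_mem_uIcc (uIoc_subset_uIcc hs)).trans_lt hr
      refine (eLpNorm_mono_measure _ Measure.restrict_le_self).trans ?_
      have h1 : eLpNorm (fun t => w (t - s) - w (t - r₀)) p volume =
          eLpNorm (translate s w - translate r₀ w : Lp E p volume) p volume := by
        refine eLpNorm_congr_ae ?_
        filter_upwards [Lp.coeFn_sub (translate s w) (translate r₀ w), coeFn_translate s w,
          coeFn_translate r₀ w] with t k1 k2 k3
        rw [k1, Pi.sub_apply, k2, k3]
      rw [h1, ← Lp.enorm_def, ← ofReal_norm]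
      exact ENNReal.ofReal_le_ofReal (hball s hs').le
  have hnorm : eLpNorm (fun t => -∫ s in r₀..r, (w (t - s) - w (t - r₀))) p
      (volume.restrict (Icc 0 T)) ≤ ENNReal.ofReal (ε * ‖r - r₀‖) := by
    refine (eLpNorm_congr_norm_ae (ae_of_all _ fun t => ?_)).trans_le (hbound.trans_eq ?_)
    · rw [norm_neg, intervalIntegral.norm_intervalIntegral_eq]
    · rw [Measure.restrict_apply_univ, Real.volume_uIoc, ENNReal.ofReal_mul hε.le, mul_comm]
      rfl
  rw [Lp.norm_def, eLpNorm_congr_ae hae]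
  exact ENNReal.toReal_le_of_le_ofReal (by positivity) hnorm

/-- The delayed primitive is `C¹` jointly in the primitive and the delay, with values in `L^p`. -/
theorem contDiff_delayed (hp : p ≠ ∞) (a T : ℝ) :
    ContDiff ℝ 1 fun z : (E × Lp E p (volume : Measure ℝ)) × ℝ => delayed a T z.2 z.1 := by
  set ρ := LpToLpRestrictCLM ℝ E ℝ volume p (Icc 0 T) with hρ
  have hlip (r r' : ℝ) (v : E × Lp E p (volume : Measure ℝ)) :
      ‖delayed a T r v - delayed a T r' v‖ ≤ ‖ρ‖ * ‖v‖ * ‖r - r'‖ := by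
    refine Convex.norm_image_sub_le_of_norm_hasDerivWithin_le (s := univ)
      (fun s _ => (hasDerivAt_delayed hp a T v s).hasDerivWithinAt) (fun s _ => ?_) convex_univ
      (mem_univ _) (mem_univ _)
    rw [norm_neg]
    refine (ρ.le_opNorm _).trans ?_
    rw [LinearIsometry.norm_map]
    gcongr
    exact norm_snd_le v
  have hc1 : Continuous fun z : (E × Lp E p (volume : Measure ℝ)) × ℝ =>
      delayed (E := E) (p := p) a T z.2 := by
    have h1 : LipschitzWith ‖ρ‖₊ fun r => delayed (E := E) (p := p) a T r := by
      refine LipschitzWith.of_dist_le_mul fun r r' => ?_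
      rw [dist_eq_norm, dist_eq_norm]
      refine ContinuousLinearMap.opNorm_le_bound _ (by positivity) fun v => ?_
      refine (hlip r r' v).trans_eq ?_
      simp only [coe_nnnorm]
      ring
    exact h1.continuous.comp continuous_snd
  have hc2 : Continuous fun z : (E × Lp E p (volume : Measure ℝ)) × ℝ =>
      ContinuousLinearMap.toSpanSingleton ℝ (-(ρ (translate z.2 z.1.2))) := by
    have h1 : Continuous fun z : (E × Lp E p (volume : Measure ℝ)) × ℝ =>
        translate z.2 z.1.2 :=
      (continuous_translate hp).comp (by fun_prop :
        Continuous fun z : (E × Lp E p (volume : Measure ℝ)) × ℝ => (z.1.2, z.2))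
    have h2 := (ρ.continuous.comp h1).neg
    exact (ContinuousLinearMap.toSpanSingletonCLE (𝕜 := ℝ)).continuous.comp h2
  rw [contDiff_one_iff_hasFDerivAt]
  refine ⟨fun z => (delayed a T z.2).coprod
    (ContinuousLinearMap.toSpanSingleton ℝ (-(ρ (translate z.2 z.1.2)))), ?_, fun z => ?_⟩
  · exact hc1.continuousLinearMapCoprod hc2
  · exact (hasStrictFDerivAt_uncurry_coprod (𝕜 := ℝ)
      (f := fun (v : E × Lp E p (volume : Measure ℝ)) (r : ℝ) => delayed a T r v)
      (f₁ := fun _ r => delayed a T r)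
      (f₂ := fun v r => ContinuousLinearMap.toSpanSingleton ℝ (-(ρ (translate r v.2))))
      (Eventually.of_forall fun v => (delayed a T v.2).hasFDerivAt (x := v.1))
      (Eventually.of_forall fun v => (hasDerivAt_delayed hp a T v.1 v.2).hasFDerivAt)
      hc1.continuousAt hc2.continuousAt).hasFDerivAt

end Delay

/-! ### Extension by zero -/

section Extend

variable {α : Type*} [MeasurableSpace α] {μ : Measure α} {E : Type*} [NormedAddCommGroup E]
  {p : ℝ≥0∞}

theorem memLp_indicator_Lp {s : Set α} (hs : MeasurableSet s) (u : Lp E p (μ.restrict s)) :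
    MemLp (s.indicator u) p μ :=
  (memLp_indicator_iff_restrict hs).2 (Lp.memLp u)

variable [NormedSpace ℝ E] [Fact (1 ≤ p)]

/-- Extension by zero from a measurable set, as a bounded linear map between `L^p` spaces. -/
def extendByZero {s : Set α} (hs : MeasurableSet s) : Lp E p (μ.restrict s) →L[ℝ] Lp E p μ :=
  LinearMap.mkContinuous
    { toFun := fun u => (memLp_indicator_Lp hs u).toLp _
      map_add' := fun u v => by
        rw [← MemLp.toLp_add]
        refine MemLp.toLp_congr _ _ ?_
        filter_upwards [(ae_restrict_iff' hs).1 (Lp.coeFn_add u v)] with t ht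
        by_cases h : t ∈ s
        · simp only [Pi.add_apply, indicator_of_mem h, ht h]
        · simp [h]
      map_smul' := fun c u => by
        rw [RingHom.id_apply, ← MemLp.toLp_const_smul]
        refine MemLp.toLp_congr _ _ ?_
        filter_upwards [(ae_restrict_iff' hs).1 (Lp.coeFn_smul c u)] with t ht
        by_cases h : t ∈ s
        · simp only [Pi.smul_apply, indicator_of_mem h, ht h]
        · simp [h] }
    1 (fun u => by
      change ‖(memLp_indicator_Lp hs u).toLp _‖ ≤ _
      rw [one_mul, Lp.norm_toLp, eLpNorm_indicator_eq_eLpNorm_restrict hs, Lp.norm_def])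

theorem coeFn_extendByZero {s : Set α} (hs : MeasurableSet s) (u : Lp E p (μ.restrict s)) :
    extendByZero hs u =ᵐ[μ] s.indicator u :=
  (memLp_indicator_Lp hs u).coeFn_toLp

end Extend

/-! ### The space `W^{1,p}([a, b], E)` as a product -/

section SobolevEquiv

/-- A function whose increments are dominated by those of an absolutely continuous function is
absolutely continuous. -/
theorem absolutelyContinuousOnInterval_of_dist_le {a b : ℝ} {X Y : Type*} [PseudoMetricSpace X]
    [PseudoMetricSpace Y] {x : ℝ → X} {y : ℝ → Y} (hy : AbsolutelyContinuousOnInterval y a b)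
    (h : ∀ s ∈ uIcc a b, ∀ t ∈ uIcc a b, dist (x s) (x t) ≤ dist (y s) (y t)) :
    AbsolutelyContinuousOnInterval x a b := by
  refine squeeze_zero' (Eventually.of_forall fun I => Finset.sum_nonneg fun _ _ => dist_nonneg)
    ?_ hy
  filter_upwards [mem_inf_of_right (mem_principal_self _)] with I hI
  exact Finset.sum_le_sum fun i hi => h _ (hI.1 i hi).1 _ (hI.1 i hi).2

theorem intervalIntegrable_Lp_restrict {F : Type*} [NormedAddCommGroup F] {p : ℝ≥0∞}
    [Fact (1 ≤ p)] {a b : ℝ} (u : Lp F p (volume.restrict (Icc a b))) {s t : ℝ}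
    (hs : s ∈ Icc a b) (ht : t ∈ Icc a b) :
    IntervalIntegrable u volume s t := by
  rw [intervalIntegrable_iff]
  have h : IntegrableOn u (Icc a b) volume := (Lp.memLp u).integrable Fact.out
  exact h.mono_set (uIoc_subset_uIcc.trans (uIcc_subset_Icc hs ht))

variable {E : Type*} [NormedAddCommGroup E] [NormedSpace ℝ E] [FiniteDimensional ℝ E]
  {p : ℝ≥0∞} {a b : ℝ}

/-- The element `t ↦ c + ∫_a^t u` of `W^{1,p}([a, b], E)`. -/
theorem exists_sobolev_eq_primitive [Fact (1 ≤ p)] (hab : a ≤ b) (c : E)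
    (u : Lp E p (volume.restrict (Icc a b))) :
    ∃ x : Sobolev E p a b, (∀ t ∈ Icc a b, x t = c + ∫ s in a..t, u s) ∧
      Sobolev.toProd x = WithLp.toLp p (c, u) := by
  have : CompleteSpace E := FiniteDimensional.complete ℝ E
  have ha : a ∈ Icc a b := left_mem_Icc.2 hab
  have hb : b ∈ Icc a b := right_mem_Icc.2 hab
  set x : ℝ → E := (Icc a b).indicator fun t => c + ∫ s in a..t, u s with hx
  have hxt (t : ℝ) (ht : t ∈ Icc a b) : x t = c + ∫ s in a..t, u s := indicator_of_mem ht _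
  have hint := intervalIntegrable_Lp_restrict u ha hb
  have hAC : AbsolutelyContinuousOnInterval x a b := by
    refine absolutelyContinuousOnInterval_of_dist_le
      (hint.norm.absolutelyContinuousOnInterval_intervalIntegral left_mem_uIcc) ?_
    intro s hs t ht
    rw [uIcc_of_le hab] at hs ht
    rw [hxt s hs, hxt t ht, dist_add_left, dist_eq_norm, Real.dist_eq,
      intervalIntegral.integral_interval_sub_left (intervalIntegrable_Lp_restrict u ha hs)
        (intervalIntegrable_Lp_restrict u ha ht),
      intervalIntegral.integral_interval_sub_left (intervalIntegrable_Lp_restrict u ha hs).norm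
        (intervalIntegrable_Lp_restrict u ha ht).norm]
    exact intervalIntegral.norm_integral_le_abs_integral_norm
  have hderiv : deriv x =ᵐ[volume.restrict (Icc a b)] u := by
    have hIoo : ∀ᵐ t ∂(volume.restrict (Icc a b)), t ∈ Ioo a b := by
      rw [← Measure.restrict_congr_set (Ioo_ae_eq_Icc (μ := volume) (a := a) (b := b))]
      exact ae_restrict_mem measurableSet_Ioo
    filter_upwards [hIoo, ae_restrict_of_ae hint.ae_hasDerivAt_integral] with t hmem ht
    have h1 := ht (by rw [uIcc_of_le hab]; exact Ioo_subset_Icc_self hmem) a left_mem_uIcc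
    refine HasDerivAt.deriv ((h1.const_add c).congr_of_eventuallyEq ?_)
    filter_upwards [isOpen_Ioo.mem_nhds hmem] with s hs
    exact hxt s (Ioo_subset_Icc_self hs)
  have hmem : MemLp (deriv x) p (volume.restrict (Icc a b)) :=
    (memLp_congr_ae hderiv).2 (Lp.memLp u)
  refine ⟨⟨x, fun t ht => indicator_of_notMem ht _, hAC, hmem⟩, hxt, ?_⟩
  change WithLp.toLp p (x a, hmem.toLp (deriv x)) = _
  have h1 : x a = c := by simp [hxt a ha]
  have h2 : hmem.toLp (deriv x) = u := by
    refine Lp.ext (hmem.coeFn_toLp.trans hderiv)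
  rw [h1, h2]

variable [Fact (1 ≤ p)]

/-- The isomorphism `x ↦ (x a, x')` of `W^{1,p}([a, b], E)` onto `E × L^p([a, b], E)`. -/
def sobolevEquiv (hab : a ≤ b) : Sobolev E p a b ≃L[ℝ] E × Lp E p (volume.restrict (Icc a b)) :=
  (LinearIsometryEquiv.ofSurjective
    (⟨Sobolev.toProd, fun _ => rfl⟩ : Sobolev E p a b →ₗᵢ[ℝ] _) (fun y => by
      obtain ⟨x, -, hx⟩ := exists_sobolev_eq_primitive hab (WithLp.ofLp y).1 (WithLp.ofLp y).2
      exact ⟨x, hx⟩)).toContinuousLinearEquiv.trans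
    (WithLp.prodContinuousLinearEquiv p ℝ E (Lp E p (volume.restrict (Icc a b))))

theorem sobolevEquiv_symm_apply (hab : a ≤ b)
    (v : E × Lp E p (volume.restrict (Icc a b))) {t : ℝ} (ht : t ∈ Icc a b) :
    (sobolevEquiv hab).symm v t = v.1 + ∫ s in a..t, v.2 s := by
  obtain ⟨x, hx, hxv⟩ := exists_sobolev_eq_primitive hab v.1 v.2
  have h : sobolevEquiv hab x = v := by
    change WithLp.ofLp (Sobolev.toProd x) = v
    rw [hxv]
  rw [← h, ContinuousLinearEquiv.symm_apply_apply, hx t ht, h]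

theorem sobolev_eq_primitive (hab : a ≤ b) (x : Sobolev E p a b) {t : ℝ} (ht : t ∈ Icc a b) :
    x t = (sobolevEquiv hab x).1 + ∫ s in a..t, (sobolevEquiv hab x).2 s := by
  rw [← sobolevEquiv_symm_apply hab _ ht, ContinuousLinearEquiv.symm_apply_apply]

end SobolevEquiv

/-! ### The solution operator of the delay equation with a globally Lipschitz right-hand side -/

section SolutionOperator

variable {E : Type*} [NormedAddCommGroup E] [NormedSpace ℝ E] {p : ℝ≥0∞} [Fact (1 ≤ p)]

/-- The history `(c, u)`, with `u` on `[-R, 0]`, and the derivative `y` on `[0, T]`, glued to an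
initial value at `-R` and a derivative on the whole line that vanishes outside `[-R, T]`. -/
def glue (R T : ℝ) : (E × Lp E p (volume.restrict (Icc (-R) 0))) ×
    Lp E p (volume.restrict (Icc 0 T)) →L[ℝ] E × Lp E p (volume : Measure ℝ) :=
  ((ContinuousLinearMap.fst ℝ _ _).comp (ContinuousLinearMap.fst ℝ _ _)).prod
    ((extendByZero measurableSet_Icc).comp
        ((ContinuousLinearMap.snd ℝ _ _).comp (ContinuousLinearMap.fst ℝ _ _)) +
      (extendByZero measurableSet_Icc).comp (ContinuousLinearMap.snd ℝ _ _))

theorem coeFn_glue_snd (R T : ℝ) (q : (E × Lp E p (volume.restrict (Icc (-R) 0))) ×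
    Lp E p (volume.restrict (Icc 0 T))) :
    (glue R T q).2 =ᵐ[volume]
      fun s => (Icc (-R) 0).indicator q.1.2 s + (Icc 0 T).indicator q.2 s := by
  filter_upwards [Lp.coeFn_add (extendByZero (measurableSet_Icc (a := -R) (b := 0)) q.1.2)
      (extendByZero (measurableSet_Icc (a := 0) (b := T)) q.2),
    coeFn_extendByZero (measurableSet_Icc (a := -R) (b := 0)) q.1.2,
    coeFn_extendByZero (measurableSet_Icc (a := 0) (b := T)) q.2] with s h1 h2 h3
  change (extendByZero (measurableSet_Icc (a := -R) (b := 0)) q.1.2 +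
      extendByZero (measurableSet_Icc (a := 0) (b := T)) q.2 : Lp E p (volume : Measure ℝ)) s = _
  rw [h1, Pi.add_apply, h2, h3]

theorem primitive_glue_of_nonpos {R : ℝ} (T : ℝ)
    (q : (E × Lp E p (volume.restrict (Icc (-R) 0))) × Lp E p (volume.restrict (Icc 0 T)))
    {t : ℝ} (ht : t ∈ Icc (-R) 0) :
    primitive (-R) (glue R T q) t = q.1.1 + ∫ s in (-R)..t, q.1.2 s := by
  have h1 : (glue R T q).1 = q.1.1 := rfl
  rw [primitive, h1]
  congr 1
  refine intervalIntegral.integral_congr_ae ?_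
  have h0 : ∀ᵐ s : ℝ, s ≠ 0 := compl_mem_ae_iff.2 (measure_singleton 0)
  filter_upwards [coeFn_glue_snd R T q, h0] with s hs hs0 hmem
  rw [uIoc_of_le ht.1] at hmem
  have h2 : s ∈ Icc (-R) 0 := ⟨hmem.1.le, hmem.2.trans ht.2⟩
  have h3 : s ∉ Icc 0 T := fun h => hs0 (le_antisymm h2.2 h.1)
  rw [hs, indicator_of_mem h2, indicator_of_notMem h3, add_zero]

theorem primitive_glue_of_nonneg {R T : ℝ}
    (q : (E × Lp E p (volume.restrict (Icc (-R) 0))) × Lp E p (volume.restrict (Icc 0 T)))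
    {t : ℝ} (ht : t ∈ Icc 0 T) :
    primitive (-R) (glue R T q) t = primitive (-R) (glue R T q) 0 + ∫ s in 0..t, q.2 s := by
  have h1 : ∫ s in 0..t, q.2 s = ∫ s in 0..t, (glue R T q).2 s := by
    refine intervalIntegral.integral_congr_ae ?_
    filter_upwards [coeFn_glue_snd R T q] with s hs hmem
    rw [uIoc_of_le ht.1] at hmem
    have h2 : s ∈ Icc 0 T := ⟨hmem.1.le, hmem.2.trans ht.2⟩
    have h3 : s ∉ Icc (-R) 0 := fun h => hmem.1.not_ge h.2
    rw [hs, indicator_of_mem h2, indicator_of_notMem h3, zero_add]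
  rw [h1, primitive, primitive, add_assoc, intervalIntegral.integral_add_adjacent_intervals
    (intervalIntegrable_Lp _ _ _) (intervalIntegrable_Lp _ _ _)]

theorem norm_primitive_glue_zero_le {R T : ℝ} (hT : 0 ≤ T) (y : Lp E p (volume.restrict (Icc 0 T)))
    (t : ℝ) : ‖primitive (-R) (glue R T (0, y)) t‖ ≤ (1 + T) * ‖y‖ := by
  have h1 : (glue R T ((0 : E × Lp E p (volume.restrict (Icc (-R) 0))), y)) =
      ((0 : E), extendByZero measurableSet_Icc y) := by
    ext : 1
    · rfl
    · change extendByZero measurableSet_Icc (0 : Lp E p (volume.restrict (Icc (-R) 0))) +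
        extendByZero measurableSet_Icc y = _
      rw [map_zero, zero_add]
  have h2 : Integrable ((Icc 0 T).indicator y) volume :=
    (integrable_indicator_iff measurableSet_Icc).2 ((Lp.memLp y).integrable Fact.out)
  have h3 : Integrable (extendByZero (measurableSet_Icc (a := 0) (b := T)) y) volume :=
    h2.congr (coeFn_extendByZero measurableSet_Icc y).symm
  rw [h1, primitive, zero_add]
  calc ‖∫ s in (-R)..t, extendByZero (measurableSet_Icc (a := 0) (b := T)) y s‖
      ≤ ∫ s in uIoc (-R) t, ‖extendByZero (measurableSet_Icc (a := 0) (b := T)) y s‖ :=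
        intervalIntegral.norm_integral_le_integral_norm_uIoc
    _ ≤ ∫ s, ‖extendByZero (measurableSet_Icc (a := 0) (b := T)) y s‖ :=
        setIntegral_le_integral h3.norm (ae_of_all _ fun _ => norm_nonneg _)
    _ = ∫ s, (Icc 0 T).indicator (fun s => ‖y s‖) s := by
        refine integral_congr_ae ?_
        filter_upwards [coeFn_extendByZero (measurableSet_Icc (a := 0) (b := T)) y] with s hs
        rw [hs, norm_indicator_eq_indicator_norm]
    _ = ∫ s in Icc 0 T, ‖y s‖ := integral_indicator measurableSet_Icc
    _ ≤ _ := by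
        refine (integral_norm_le_of_memLp Fact.out (Lp.memLp y)).trans_eq ?_
        rw [measureReal_restrict_apply_univ, Real.volume_real_Icc_of_le hT, sub_zero, Lp.norm_def]

variable {g : E × E → E}

theorem memLp_delayRHS (hg : Continuous g) (a T : ℝ)
    (z : (E × Lp E p (volume : Measure ℝ)) × ℝ) :
    MemLp (fun t => g (primitive a z.1 t, primitive a z.1 (t - z.2))) p
      (volume.restrict (Icc 0 T)) := by
  have h := continuous_primitive_right a z.1
  exact memLp_restrict_Icc_of_continuous
    (hg.comp (h.prodMk (h.comp (by fun_prop : Continuous fun t : ℝ => t - z.2))))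

/-- The right-hand side `t ↦ g (x t, x (t - r))` of the delay equation on `[0, T]`, along the
primitive `x` given by `z.1` and with the delay `r = z.2`. -/
def delayRHS (hg : Continuous g) (a T : ℝ) (z : (E × Lp E p (volume : Measure ℝ)) × ℝ) :
    Lp E p (volume.restrict (Icc 0 T)) :=
  (memLp_delayRHS hg a T z).toLp _

theorem coeFn_delayRHS (hg : Continuous g) (a T : ℝ)
    (z : (E × Lp E p (volume : Measure ℝ)) × ℝ) :
    delayRHS hg a T z =ᵐ[volume.restrict (Icc 0 T)]
      fun t => g (primitive a z.1 t, primitive a z.1 (t - z.2)) :=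
  (memLp_delayRHS hg a T z).coeFn_toLp

theorem contDiff_delayRHS [CompleteSpace E] (hp : p ≠ ∞) (hg : ContDiff ℝ 1 g) (a T : ℝ) :
    ContDiff ℝ 1 (delayRHS (p := p) hg.continuous a T) := by
  set A₁ := (ContinuousLinearMap.inl ℝ E E).compLpL p (volume.restrict (Icc 0 T))
  set A₂ := (ContinuousLinearMap.inr ℝ E E).compLpL p (volume.restrict (Icc 0 T))
  refine contDiff_superposition (K := Icc 0 T) isCompact_Icc (ae_restrict_mem measurableSet_Icc) hg
    (v := fun (z : (E × Lp E p (volume : Measure ℝ)) × ℝ) t =>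
      (primitive a z.1 t, primitive a z.1 (t - z.2)))
    (vbar := fun z => A₁ (delayed a T 0 z.1) + A₂ (delayed a T z.2 z.1)) ?_ ?_ ?_
    (coeFn_delayRHS hg.continuous a T)
  · have h := continuous_primitive (E := E) (p := p) a
    exact (h.comp (by fun_prop : Continuous
        fun q : ((E × Lp E p (volume : Measure ℝ)) × ℝ) × ℝ => (q.1.1, q.2))).prodMk
      (h.comp (by fun_prop : Continuous
        fun q : ((E × Lp E p (volume : Measure ℝ)) × ℝ) × ℝ => (q.1.1, q.2 - q.1.2)))
  · exact (A₁.contDiff.comp ((delayed a T 0).contDiff.comp contDiff_fst)).add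
      (A₂.contDiff.comp (contDiff_delayed hp a T))
  · intro z
    filter_upwards [Lp.coeFn_add (A₁ (delayed a T 0 z.1)) (A₂ (delayed a T z.2 z.1)),
      (ContinuousLinearMap.inl ℝ E E).coeFn_compLpL (delayed a T 0 z.1),
      (ContinuousLinearMap.inr ℝ E E).coeFn_compLpL (delayed a T z.2 z.1),
      coeFn_delayed a T 0 z.1, coeFn_delayed a T z.2 z.1] with t h1 h2 h3 h4 h5
    rw [h1, Pi.add_apply, h2, h3, h4, h5]
    simp

/-- For a Lipschitz right-hand side and a short time interval, the solutions of the delay equation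
are given by a `C¹` map of the history and the delay. The primitives are constant outside `[-R, T]`,
so every real number is admissible as a delay. In `hsmall`, the factor `T ^ (1 / p)` bounds the
`L^p` norm on `[0, T]` by the supremum norm, and `1 + T` bounds the `L^1` norm by the `L^p` norm. -/
theorem exists_contDiff_solutionOperator [CompleteSpace E] (hp : p ≠ ∞) (hg : ContDiff ℝ 1 g)
    {L : NNReal} (hL : LipschitzWith L g) (R : ℝ) {T : ℝ} (hT : 0 ≤ T)
    (hsmall : T ^ p.toReal⁻¹ * (L * (1 + T)) ≤ 1 / 2) :
    ∃ V : (E × Lp E p (volume.restrict (Icc (-R) 0))) × ℝ → E × Lp E p (volume : Measure ℝ),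
      ContDiff ℝ 1 V ∧ ∀ u,
        (∀ t ∈ Icc (-R) 0, primitive (-R) (V u) t = u.1.1 + ∫ s in (-R)..t, u.1.2 s) ∧
        ∀ t ∈ Icc 0 T, primitive (-R) (V u) t = primitive (-R) (V u) 0 +
          ∫ s in 0..t, g (primitive (-R) (V u) s, primitive (-R) (V u) (s - u.2)) := by
  set G : ((E × Lp E p (volume.restrict (Icc (-R) 0))) × ℝ) × Lp E p (volume.restrict (Icc 0 T)) →
      Lp E p (volume.restrict (Icc 0 T)) :=
    fun q => delayRHS hg.continuous (-R) T (glue R T (q.1.1, q.2), q.1.2) with hG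
  have hGc : ContDiff ℝ 1 G := by
    have h1 : ContDiff ℝ 1 fun q : ((E × Lp E p (volume.restrict (Icc (-R) 0))) × ℝ) ×
        Lp E p (volume.restrict (Icc 0 T)) => (q.1.1, q.2) :=
      contDiff_fst.fst.prodMk contDiff_snd
    have h2 : ContDiff ℝ 1 fun q : ((E × Lp E p (volume.restrict (Icc (-R) 0))) × ℝ) ×
        Lp E p (volume.restrict (Icc 0 T)) => (glue R T (q.1.1, q.2), q.1.2) :=
      ((glue (E := E) (p := p) R T).contDiff.comp h1).prodMk contDiff_fst.snd
    exact (contDiff_delayRHS hp hg (-R) T).comp h2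
  have hvol : (measureUnivNNReal (volume.restrict (Icc 0 T)) : ℝ) = T := by
    rw [measureUnivNNReal, Measure.restrict_apply_univ, Real.volume_Icc, sub_zero]
    exact ENNReal.toReal_ofReal hT
  have hGL (u) : LipschitzWith (1 / 2) fun y => G (u, y) := by
    refine LipschitzWith.of_dist_le_mul fun y₁ y₂ => ?_
    rw [dist_eq_norm, dist_eq_norm]
    have hae : ∀ᵐ t ∂(volume.restrict (Icc 0 T)),
        ‖(G (u, y₁) - G (u, y₂)) t‖ ≤ L * ((1 + T) * ‖y₁ - y₂‖) := by
      filter_upwards [Lp.coeFn_sub (G (u, y₁)) (G (u, y₂)),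
        coeFn_delayRHS hg.continuous (-R) T (glue R T (u.1, y₁), u.2),
        coeFn_delayRHS hg.continuous (-R) T (glue R T (u.1, y₂), u.2)] with t h1 h2 h3
      rw [h1, Pi.sub_apply, h2, h3, ← dist_eq_norm]
      refine (hL.dist_le_mul _ _).trans ?_
      gcongr
      have h4 (s : ℝ) : dist (primitive (-R) (glue R T (u.1, y₁)) s)
          (primitive (-R) (glue R T (u.1, y₂)) s) ≤ (1 + T) * ‖y₁ - y₂‖ := by
        rw [dist_eq_norm, ← primitive_sub, ← map_sub, Prod.mk_sub_mk, sub_self]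
        exact norm_primitive_glue_zero_le hT _ s
      exact max_le (h4 _) (h4 _)
    refine (Lp.norm_le_of_ae_bound (by positivity) hae).trans ?_
    rw [hvol]
    calc T ^ p.toReal⁻¹ * (L * ((1 + T) * ‖y₁ - y₂‖))
        = T ^ p.toReal⁻¹ * (L * (1 + T)) * ‖y₁ - y₂‖ := by ring
      _ ≤ 1 / 2 * ‖y₁ - y₂‖ := by gcongr
      _ = _ := by simp
  obtain ⟨y, hy, hfix⟩ := exists_contDiff_fixedPoint hGc
    (by rw [← NNReal.coe_lt_coe]; norm_num) hGL
  refine ⟨fun u => glue R T (u.1, y u), (glue (E := E) (p := p) R T).contDiff.comp (contDiff_fst.prodMk hy),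
    fun u => ⟨fun t ht => primitive_glue_of_nonpos T _ ht, fun t ht => ?_⟩⟩
  rw [primitive_glue_of_nonneg _ ht]
  congr 1
  refine intervalIntegral.integral_congr_ae ?_
  have h1 : y u =ᵐ[volume.restrict (Icc 0 T)] fun s =>
      g (primitive (-R) (glue R T (u.1, y u)) s,
        primitive (-R) (glue R T (u.1, y u)) (s - u.2)) := by
    have h2 := coeFn_delayRHS hg.continuous (-R) T (glue R T (u.1, y u), u.2)
    have h3 : delayRHS hg.continuous (-R) T (glue R T (u.1, y u), u.2) = y u := hfix u
    rwa [h3] at h2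
  filter_upwards [(ae_restrict_iff' measurableSet_Icc).1 h1] with s hs hmem
  rw [uIoc_of_le ht.1] at hmem
  exact hs ⟨hmem.1.le, hmem.2.trans ht.2⟩

theorem exists_pos_mul_le_one_and_rpow_mul_le_half (hp : p ≠ ∞) (L K : ℝ) :
    ∃ T : ℝ, 0 < T ∧ K * T ≤ 1 ∧ T ^ p.toReal⁻¹ * (L * (1 + T)) ≤ 1 / 2 := by
  have hq : 0 < p.toReal :=
    ENNReal.toReal_pos (zero_lt_one.trans_le (Fact.out : 1 ≤ p)).ne' hp
  have h1 : Continuous fun T : ℝ => T ^ p.toReal⁻¹ * (L * (1 + T)) :=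
    (Real.continuous_rpow_const (by positivity)).mul (by fun_prop)
  have h2 : Continuous fun T : ℝ => K * T := by fun_prop
  have h3 : ∀ᶠ T : ℝ in 𝓝 0, T ^ p.toReal⁻¹ * (L * (1 + T)) < 1 / 2 :=
    (h1.tendsto 0).eventually_lt_const (by simp [Real.zero_rpow (inv_pos.2 hq).ne'])
  have h4 : ∀ᶠ T : ℝ in 𝓝 0, K * T < 1 := (h2.tendsto 0).eventually_lt_const (by simp)
  obtain ⟨T, ⟨h5, h6⟩, h7⟩ := (((h3.and h4).filter_mono nhdsWithin_le_nhds).and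
    (self_mem_nhdsWithin : Ioi (0 : ℝ) ∈ 𝓝[>] 0)).exists
  exact ⟨T, h7, h6.le, h5.le⟩

end SolutionOperator

/-! ### Uniqueness and maximal solutions -/

section Maximal

variable {E : Type*} [NormedAddCommGroup E] [NormedSpace ℝ E]
  {f : E × E → E} {R r : ℝ} {φ : ℝ → E} {S S' : EReal} {x z : ℝ → E}

theorem IsSolution.continuousOn (hx : IsSolution f R r φ S x) {t : ℝ} (ht : (t : EReal) < S) :
    ContinuousOn x (Icc 0 t) := fun s hs =>
  ((hx.2 s hs.1 ((EReal.coe_le_coe_iff.2 hs.2).trans_lt ht)).continuousWithinAt).mono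
    Icc_subset_Ici_self

theorem IsSolution.exists_norm_le (hφ : ContinuousOn φ (Icc (-R) 0))
    (hx : IsSolution f R r φ S x) {t : ℝ} (ht : (t : EReal) < S) :
    ∃ C, ∀ s ∈ Icc (-R) t, ‖x s‖ ≤ C := by
  obtain ⟨C₁, h₁⟩ := isCompact_Icc.exists_bound_of_continuousOn hφ
  obtain ⟨C₂, h₂⟩ := isCompact_Icc.exists_bound_of_continuousOn (hx.continuousOn ht)
  refine ⟨max C₁ C₂, fun s hs => ?_⟩
  rcases le_total s 0 with h | h
  · rw [hx.1 s ⟨hs.1, h⟩]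
    exact (h₁ s ⟨hs.1, h⟩).trans (le_max_left _ _)
  · exact (h₂ s ⟨h, hs.2⟩).trans (le_max_right _ _)

variable [FiniteDimensional ℝ E]

/-- Two solutions with the same history agree where both are defined: the maximum of their distance
with the weight `exp (-l t)` is at most a fixed fraction of itself when `l` exceeds a Lipschitz
constant of the right-hand side. -/
theorem IsSolution.eq_of_lt (hf : ContDiff ℝ 1 f) (hr : r ∈ Icc 0 R)
    (hφ : ContinuousOn φ (Icc (-R) 0)) (hx : IsSolution f R r φ S x)
    (hz : IsSolution f R r φ S' z) {t : ℝ} (htR : -R ≤ t) (htS : (t : EReal) < S)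
    (htS' : (t : EReal) < S') : x t = z t := by
  rcases le_total t 0 with ht0 | ht0
  · rw [hx.1 t ⟨htR, ht0⟩, hz.1 t ⟨htR, ht0⟩]
  obtain ⟨C₁, hC₁⟩ := hx.exists_norm_le hφ htS
  obtain ⟨C₂, hC₂⟩ := hz.exists_norm_le hφ htS'
  obtain ⟨g, L, -, -, hL, -, hgf⟩ :=
    exists_contDiff_lipschitzWith_bounded_eqOn_closedBall hf (max C₁ C₂)
  set l : ℝ := L + 1 with hl
  have hl0 : 0 < l := by positivity
  set d : ℝ → E := fun s => x s - z s with hd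
  have hdc : ContinuousOn d (Icc 0 t) := (hx.continuousOn htS).sub (hz.continuousOn htS')
  obtain ⟨s₀, hs₀, hmax⟩ := isCompact_Icc.exists_isMaxOn (nonempty_Icc.2 ht0)
    (f := fun s => Real.exp (-(l * s)) * ‖d s‖)
    ((by fun_prop : Continuous fun s => Real.exp (-(l * s))).continuousOn.mul hdc.norm)
  set m := Real.exp (-(l * s₀)) * ‖d s₀‖ with hm
  have hm0 : 0 ≤ m := by positivity
  have hdm (s : ℝ) (hs : s ∈ Icc (-R) t) : ‖d s‖ ≤ m * Real.exp (l * s) := by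
    rcases le_total s 0 with h | h
    · have : d s = 0 := by simp [hd, hx.1 s ⟨hs.1, h⟩, hz.1 s ⟨hs.1, h⟩]
      rw [this, norm_zero]
      positivity
    · have h1 : Real.exp (-(l * s)) * ‖d s‖ ≤ m := hmax ⟨h, hs.2⟩
      rw [Real.exp_neg, inv_mul_le_iff₀ (Real.exp_pos _)] at h1
      linarith
  have hderiv (s : ℝ) (hs : s ∈ Ico 0 t) : HasDerivWithinAt d
      (f (x s, x (s - r)) - f (z s, z (s - r))) (Ici s) s := by
    have h := EReal.coe_le_coe_iff.2 hs.2.le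
    exact ((hx.2 s hs.1 (h.trans_lt htS)).sub (hz.2 s hs.1 (h.trans_lt htS'))).mono
      (Ici_subset_Ici.2 hs.1)
  have hbound (s : ℝ) (hs : s ∈ Ico 0 t) :
      ‖f (x s, x (s - r)) - f (z s, z (s - r))‖ ≤ L * m * Real.exp (l * s) := by
    have hR : 0 ≤ R := hr.1.trans hr.2
    have hs1 : s ∈ Icc (-R) t := ⟨by linarith [hs.1], hs.2.le⟩
    have hs2 : s - r ∈ Icc (-R) t := ⟨by linarith [hs.1, hr.2], by linarith [hs.2, hr.1]⟩
    have hxg : g (x s, x (s - r)) = f (x s, x (s - r)) :=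
      hgf _ (max_le ((hC₁ _ hs1).trans (le_max_left _ _)) ((hC₁ _ hs2).trans (le_max_left _ _)))
    have hzg : g (z s, z (s - r)) = f (z s, z (s - r)) :=
      hgf _ (max_le ((hC₂ _ hs1).trans (le_max_right _ _)) ((hC₂ _ hs2).trans (le_max_right _ _)))
    rw [← hxg, ← hzg, ← dist_eq_norm, mul_assoc]
    refine (hL.dist_le_mul _ _).trans ?_
    gcongr
    refine max_le ?_ ?_
    · rw [dist_eq_norm]
      exact hdm s hs1
    · rw [dist_eq_norm]
      refine (hdm _ hs2).trans ?_
      gcongr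
      linarith [hr.1]
  -- Since `‖d s‖ ≤ m exp (l s)`, the mean value inequality gives `‖d s‖ ≤ (L / l) m exp (l s)`;
  -- at the maximum point this forces `m = 0`.
  have hB (s : ℝ) : HasDerivAt (fun s => L * m / l * Real.exp (l * s))
      (L * m * Real.exp (l * s)) s := by
    have h1 : HasDerivAt (fun s : ℝ => l * s) l s := by simpa using (hasDerivAt_id s).const_mul l
    convert! h1.exp.const_mul (L * m / l) using 1
    field_simp
  have hd0 : ‖d 0‖ ≤ L * m / l * Real.exp (l * 0) := by
    have : d 0 = 0 := by
      have h0 : (0 : ℝ) ∈ Icc (-R) 0 := ⟨by linarith [hr.1, hr.2], le_rfl⟩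
      simp [hd, hx.1 0 h0, hz.1 0 h0]
    rw [this, norm_zero]
    positivity
  have hkey := image_norm_le_of_norm_deriv_right_le_deriv_boundary hdc hderiv hd0 hB hbound hs₀
  have hm1 : m ≤ L * m / l := by
    have h1 : m = (Real.exp (l * s₀))⁻¹ * ‖d s₀‖ := by rw [hm, Real.exp_neg]
    rw [← inv_mul_le_iff₀' (Real.exp_pos _), ← h1] at hkey
    exact hkey
  have hm2 : m = 0 := by
    rw [le_div_iff₀ hl0, hl] at hm1
    nlinarith
  have h3 := hdm t ⟨htR, le_rfl⟩
  rw [hm2, zero_mul] at h3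
  exact sub_eq_zero.1 (norm_le_zero_iff.1 h3)

/-- A solution extends to a maximal one: by uniqueness all solutions glue. -/
theorem IsSolution.exists_isMaximalSolution (hf : ContDiff ℝ 1 f) (hr : r ∈ Icc 0 R)
    (hφ : ContinuousOn φ (Icc (-R) 0)) (hS : 0 < S) (hx : IsSolution f R r φ S x) :
    ∃ (S' : EReal) (z : ℝ → E), IsMaximalSolution f R r φ S' z ∧ S ≤ S' := by
  classical
  set A : Set EReal := {S' | ∃ z, IsSolution f R r φ S' z} with hA
  let y : ℝ → E := fun t =>
    if h : ∃ q : EReal × (ℝ → E), IsSolution f R r φ q.1 q.2 ∧ (t : EReal) < q.1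
    then h.choose.2 t else 0
  have hy {S' : EReal} {z : ℝ → E} (hz : IsSolution f R r φ S' z) {t : ℝ} (htR : -R ≤ t)
      (ht : (t : EReal) < S') : z t = y t := by
    have h : ∃ q : EReal × (ℝ → E), IsSolution f R r φ q.1 q.2 ∧ (t : EReal) < q.1 :=
      ⟨(S', z), hz, ht⟩
    simp only [y, dif_pos h]
    exact hz.eq_of_lt hf hr hφ h.choose_spec.1 htR ht h.choose_spec.2
  have hSA : S ≤ sSup A := le_sSup ⟨x, hx⟩
  refine ⟨sSup A, y, ⟨hS.trans_le hSA, ⟨fun t ht => ?_, fun t ht0 ht => ?_⟩, fun S' z hz =>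
    ⟨le_sSup ⟨z, hz⟩, fun t htR ht => hy hz htR ht⟩⟩, hSA⟩
  · have h0 : (t : EReal) < S := lt_of_le_of_lt (by exact_mod_cast ht.2) hS
    rw [← hy hx ht.1 h0, hx.1 t ht]
  · obtain ⟨S', ⟨z, hz⟩, htS'⟩ := lt_sSup_iff.1 ht
    have hR : 0 ≤ R := hr.1.trans hr.2
    have h1 : z t = y t := hy hz (by linarith) htS'
    have h2 : z (t - r) = y (t - r) := hy hz (by linarith [hr.2])
      (lt_of_le_of_lt (EReal.coe_le_coe_iff.2 (by linarith [hr.1])) htS')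
    rw [← h1, ← h2]
    refine (hz.2 t ht0 htS').congr_of_eventuallyEq ?_ h1.symm
    have h3 : ∀ᶠ s : ℝ in 𝓝 t, (s : EReal) < S' :=
      (isOpen_Iio.preimage continuous_coe_real_ereal).mem_nhds htS'
    filter_upwards [h3.filter_mono nhdsWithin_le_nhds, self_mem_nhdsWithin] with s hs hs0
    exact (hy hz (by linarith [mem_Ici.1 hs0]) hs).symm

end Maximal

/-! ### Solutions from the solution operator -/

section Assemble

variable {E : Type*} [NormedAddCommGroup E] [NormedSpace ℝ E] [FiniteDimensional ℝ E]

/-- A continuous solution of the integral equation for `g` solves the initial value problem for `f`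
when its values stay where `g` agrees with `f`, which a bound on `g` ensures for short times. -/
theorem isSolution_of_integral_eq {f g : E × E → E} (hg : Continuous g) {K M R T r : ℝ}
    (hK : ∀ q, ‖g q‖ ≤ K) (hKT : K * T ≤ 1) (hgf : ∀ q, ‖q‖ ≤ M + 1 → g q = f q)
    (hr : r ∈ Icc 0 R) {φ x : ℝ → E} (hφ : ∀ t ∈ Icc (-R) 0, ‖φ t‖ ≤ M) (hx : Continuous x)
    (hxφ : ∀ t ∈ Icc (-R) 0, x t = φ t)
    (hxg : ∀ t ∈ Icc 0 T, x t = x 0 + ∫ s in 0..t, g (x s, x (s - r))) :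
    IsSolution f R r φ T x := by
  have : CompleteSpace E := FiniteDimensional.complete ℝ E
  have hR : 0 ≤ R := hr.1.trans hr.2
  have hK0 : 0 ≤ K := (norm_nonneg _).trans (hK 0)
  have h0 : (0 : ℝ) ∈ Icc (-R) 0 := ⟨by linarith, le_rfl⟩
  have hxb (t : ℝ) (ht : t ∈ Icc (-R) T) : ‖x t‖ ≤ M + 1 := by
    rcases le_total t 0 with h | h
    · rw [hxφ t ⟨ht.1, h⟩]
      linarith [hφ t ⟨ht.1, h⟩]
    · rw [hxg t ⟨h, ht.2⟩]
      refine (norm_add_le _ _).trans (add_le_add ?_ ?_)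
      · rw [hxφ 0 h0]
        exact hφ 0 h0
      · refine (intervalIntegral.norm_integral_le_of_norm_le_const fun s _ => hK _).trans ?_
        rw [sub_zero, abs_of_nonneg h]
        exact (mul_le_mul_of_nonneg_left ht.2 hK0).trans hKT
  refine ⟨hxφ, fun t ht0 htT => ?_⟩
  have htT' : t < T := EReal.coe_lt_coe_iff.1 htT
  have hgx : Continuous fun s => g (x s, x (s - r)) :=
    hg.comp (hx.prodMk (hx.comp (by fun_prop : Continuous fun s : ℝ => s - r)))
  have h1 : g (x t, x (t - r)) = f (x t, x (t - r)) :=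
    hgf _ (max_le (hxb t ⟨by linarith, htT'.le⟩)
      (hxb (t - r) ⟨by linarith [hr.2], by linarith [hr.1]⟩))
  have h2 : HasDerivAt (fun t => x 0 + ∫ s in 0..t, g (x s, x (s - r)))
      (g (x t, x (t - r))) t := (hgx.integral_hasStrictDerivAt 0 t).hasDerivAt.const_add _
  rw [← h1]
  refine h2.hasDerivWithinAt.congr_of_eventuallyEq ?_ (hxg t ⟨ht0, htT'.le⟩)
  filter_upwards [nhdsWithin_le_nhds (Iio_mem_nhds htT'), self_mem_nhdsWithin] with s hs hs0
  exact hxg s ⟨hs0, (mem_Iio.1 hs).le⟩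

theorem accPt_prod_Icc {X : Type*} [TopologicalSpace X] {B : Set X} {R : ℝ} (hR : 0 < R)
    {u : X × ℝ} (hu : u ∈ B ×ˢ Icc 0 R) : AccPt u (𝓟 (B ×ˢ Icc 0 R)) := by
  have h1 : AccPt u.2 (𝓟 (Icc 0 R)) := by
    have h2 : (Icc 0 R).Nontrivial := ⟨0, left_mem_Icc.2 hR.le, R, right_mem_Icc.2 hR.le, hR.ne⟩
    exact isPreconnected_Icc.preperfect_of_nontrivial h2 _ hu.2
  have h2 := h1.map (f := fun r => (u.1, r)) (by fun_prop) (Prod.mk_right_injective u.1)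
  refine h2.mono ?_
  rw [map_principal, principal_mono]
  rintro _ ⟨r, hr, rfl⟩
  exact ⟨hu.1, hr⟩

/-- The derivative within the set is unique since the set is a set of unique differentiability. -/
theorem contFrechetDiffOn_of_contDiff {X Y : Type*} [NormedAddCommGroup X] [NormedSpace ℝ X]
    [NormedAddCommGroup Y] [NormedSpace ℝ Y] {g : X × ℝ → Y} (hg : ContDiff ℝ 1 g) {B : Set X}
    (hB : IsOpen B) {R : ℝ} (hR : 0 < R) : ContFrechetDiffOn g (B ×ˢ Icc 0 R) := by
  refine ⟨fun u hu => accPt_prod_Icc hR hu, fderiv ℝ g,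
    (hg.continuous_fderiv one_ne_zero).continuousOn, fun u hu => ?_⟩
  have h1 : HasFDerivWithinAt g (fderiv ℝ g u) (B ×ˢ Icc 0 R) u :=
    (hg.differentiable one_ne_zero u).hasFDerivAt.hasFDerivWithinAt
  have h2 : UniqueDiffOn ℝ (B ×ˢ Icc 0 R) := hB.uniqueDiffOn.prod (uniqueDiffOn_Icc hR)
  exact ⟨h1, fun A hA => (h2 u hu).eq hA h1⟩

end Assemble

end DelayEq

end

/-! ### Differentiability of the solution map into `W^{1,p}` -/

theorem mainTheorem1 {E : Type*} [NormedAddCommGroup E] [NormedSpace ℝ E] [FiniteDimensional ℝ E]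
    (p : ℝ≥0∞) [Fact (1 ≤ p)] (hp : p ≠ ∞) (R : ℝ) (hR : 0 < R)
    (f : E × E → E) (hf : ContDiff ℝ 1 f)
    (B : Set (DelayEq.Sobolev E p (-R) 0)) (hBopen : IsOpen B)
    (hBbdd : ∃ M : ℝ, ∀ φ ∈ B, ∀ t ∈ Icc (-R) 0, ‖φ t‖ ≤ M) :
    ∃ T : ℝ, 0 < T ∧ ∃ X : DelayEq.Sobolev E p (-R) 0 × ℝ → DelayEq.Sobolev E p (-R) T,
      (∀ φ ∈ B, ∀ r ∈ Icc 0 R, ∃ (S : EReal) (x : ℝ → E),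
        DelayEq.IsMaximalSolution f R r φ S x ∧ (T : EReal) < S ∧
          ∀ t ∈ Icc (-R) T, X (φ, r) t = x t) ∧
      DelayEq.ContFrechetDiffOn X (B ×ˢ Icc 0 R) := by
  open DelayEq in
  have : CompleteSpace E := FiniteDimensional.complete ℝ E
  obtain ⟨M, hM⟩ := hBbdd
  obtain ⟨g, L, K, hg, hL, hK, hgf⟩ :=
    exists_contDiff_lipschitzWith_bounded_eqOn_closedBall hf (M + 1)
  -- The equation is solved on `[0, T₁]` and the solution is restricted to the first half, which
  -- leaves room for the maximal solution to live beyond `T₁ / 2`.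
  obtain ⟨T₁, hT₁, hKT, hsmall⟩ := exists_pos_mul_le_one_and_rpow_mul_le_half hp L K
  obtain ⟨V, hV, hVsol⟩ := exists_contDiff_solutionOperator hp hg hL R hT₁.le hsmall
  have hR0 : -R ≤ 0 := by linarith
  have hRT : -R ≤ T₁ / 2 := by linarith
  let H : Sobolev E p (-R) 0 × ℝ → (E × Lp E p (volume.restrict (Icc (-R) 0))) × ℝ :=
    fun u => (sobolevEquiv hR0 u.1, u.2)
  have hH : ContDiff ℝ 1 H :=
    ((sobolevEquiv (E := E) (p := p) hR0).contDiff.comp contDiff_fst).prodMk contDiff_snd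
  let res := LpToLpRestrictCLM ℝ E ℝ volume p (Icc (-R) (T₁ / 2))
  let X : Sobolev E p (-R) 0 × ℝ → Sobolev E p (-R) (T₁ / 2) :=
    fun u => (sobolevEquiv hRT).symm ((V (H u)).1, res (V (H u)).2)
  have hX : ContDiff ℝ 1 X :=
    (sobolevEquiv (E := E) (p := p) hRT).symm.contDiff.comp
      ((hV.comp hH).fst.prodMk (res.contDiff.comp (hV.comp hH).snd))
  have hXt (u : Sobolev E p (-R) 0 × ℝ) (t : ℝ) (ht : t ∈ Icc (-R) (T₁ / 2)) :
      X u t = primitive (-R) (V (H u)) t := by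
    change (sobolevEquiv hRT).symm _ t = _
    rw [sobolevEquiv_symm_apply hRT _ ht, primitive]
    congr 1
    refine intervalIntegral.integral_congr_ae ?_
    filter_upwards [(ae_restrict_iff' measurableSet_Icc).1
      (LpToLpRestrictCLM_coeFn ℝ (Icc (-R) (T₁ / 2)) (V (H u)).2)] with s hs hmem
    rw [uIoc_of_le ht.1] at hmem
    exact hs ⟨hmem.1.le, hmem.2.trans ht.2⟩
  refine ⟨T₁ / 2, half_pos hT₁, X, fun φ hφ r hr => ?_,
    contFrechetDiffOn_of_contDiff hX hBopen hR⟩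
  obtain ⟨hpast, hfuture⟩ := hVsol (H (φ, r))
  have hsol : IsSolution f R r φ T₁ (primitive (-R) (V (H (φ, r)))) :=
    isSolution_of_integral_eq hg.continuous hK hKT hgf hr (hM φ hφ)
      (continuous_primitive_right _ _)
      (fun t ht => (hpast t ht).trans (sobolev_eq_primitive hR0 φ ht).symm) hfuture
  have hφc : ContinuousOn φ (Icc (-R) 0) := by
    have h := φ.2.2.1.continuousOn
    rwa [uIcc_of_le hR0] at h
  obtain ⟨S, x, hmax, hS⟩ := hsol.exists_isMaximalSolution hf hr hφc (by exact_mod_cast hT₁)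
  have hTS : ((T₁ / 2 : ℝ) : EReal) < T₁ := EReal.coe_lt_coe_iff.2 (half_lt_self hT₁)
  exact ⟨S, x, hmax, hTS.trans_le hS, fun t ht => (hXt _ t ht).trans
    ((hmax.2.2 _ _ hsol).2 t ht.1 ((EReal.coe_le_coe_iff.2 ht.2).trans_lt hTS))⟩
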